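/- Let $\mathfrak A\neq 0$ be a C*-algebra (unital or not). Write $\mathfrak{uA}$ for $\mathfrak A$ if $\mathfrak A$ is unital and for its standard unitization $\mathfrak A\oplus\mathbb C 1$ otherwise, $\mathfrak A^{**}$ for the enveloping von Neumann algebra of $\mathfrak A$ (so $\mathfrak{uA}\subseteq\mathfrak A^{**}$), and $\mathscr S(\mathfrak A)$ for the state space of $\mathfrak A$; each state is identified with its unique extensions to a state of $\mathfrak{uA}$ and to a normal state of $\mathfrak A^{**}$. A Lipschitz triple $(\mathfrak A,\mathsf L,\mathfrak M)$ consists of $\mathfrak A$, of a seminorm $\mathsf L$ defined on a dense real subspace of the self-adjoint part $\mathfrak{sa}(\mathfrak{uA})$ with $\{a:\mathsf L(a)=0\}=\mathbb R 1$ (put $\mathsf L(a)=\infty$ off this subspace), and of an Abelian C*-subalgebra $\mathfrak M\subseteq\mathfrak A$ which contains an approximate identity for $\mathfrak A$. Let $\sigma(\mathfrak M)$ be the Gel'fand spectrum of $\mathfrak M$; for compact $K\subseteq\sigma(\mathfrak M)$ let $\mathbb 1_K\in\mathfrak M^{**}\subseteq\mathfrak A^{**}$ be the indicator function of $K$. Put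 $\mathscr S(\mathfrak A|K)=\{\varphi\in\mathscr S(\mathfrak A):\varphi(\mathbb 1_K)=1\}$; a state is local if it lies in $\mathscr S(\mathfrak A|K)$ for some compact $K$. For a state $\mu$ let $$\mathfrak L_1(\mathfrak A,\mathsf L,\mu)=\{a\in\mathfrak{sa}(\mathfrak{uA}):\mathsf L(a)\le 1,\ \mu(a)=0\},$$ and let $\mathsf{mk}_{\mathsf L}(\varphi,\psi)=\sup\{|\varphi(a)-\psi(a)|:a\in\mathfrak{sa}(\mathfrak A),\ \mathsf L(a)\le1\}\in[0,\infty]$ for states $\varphi,\psi$. A set $\mathscr K\subseteq\mathscr S(\mathfrak A)$ is tame if, for some local state $\mu$, $$\lim_{K}\ \sup\{|\varphi(a-\mathbb 1_K a\mathbb 1_K)|:a\in\mathfrak L_1(\mathfrak A,\mathsf L,\mu),\ \varphi\in\mathscr K\}=0,$$ the limit being taken along the compact subsets $K$ of $\sigma(\mathfrak M)$ directed by inclusion. The triple is a quantum locally compact metric space if (a) $\mathscr S(\mathfrak A|K)$ has finite diameter for $\mathsf{mk}_{\mathsf L}$ for every compact $K\subseteq\sigma(\mathfrak M)$, and (b)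 on every tame set $\mathscr K$ the topology induced by $\mathsf{mk}_{\mathsf L}$ is the relative weak* topology. The topographic uniform topology on $\mathfrak{uA}$ is the locally convex topology generated by the seminorms $a\mapsto\|\mathbb 1_K a\mathbb 1_K\|_{\mathfrak A^{**}}$, $K\subseteq\sigma(\mathfrak M)$ compact. Theorem. For a Lipschitz triple $(\mathfrak A,\mathsf L,\mathfrak M)$ with $\mathfrak A\ne0$ the following are equivalent: 1. $(\mathfrak A,\mathsf L,\mathfrak M)$ is a quantum locally compact metric space; 2. for all local states $\mu$, the set $\mathfrak L_1(\mathfrak A,\mathsf L,\mu)$ is totally bounded in the topographic uniform topology; 3. for all local states $\mu$ and all compact $K\subseteq\sigma(\mathfrak M)$, the set $\mathbb 1_K\mathfrak L_1(\mathfrak A,\mathsf L,\mu)\mathbb 1_K$ is norm totally bounded in $\mathfrak A^{**}$; 4. for some local state $\mu$, the set $\mathfrak L_1(\mathfrak A,\mathsf L,\mu)$ is totally bounded in the topographic uniform topology; 5. for some local state $\mu$ and all compact $K\subseteq\sigma(\mathfrak M)$, the set $\mathbb 1_K\mathfrak L_1(\mathfrak A,\mathsf L,\mu)\mathbb 1_K$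 is norm totally bounded in $\mathfrak A^{**}$. -/

import Mathlib

noncomputable section

namespace QuantumMetric

open Filter Topology
open scoped ENNReal ComplexOrder InnerProductSpace

universe u

section Unitization

variable (A : Type u) [NonUnitalCStarAlgebra A]

/-- The unital star subalgebra `A + ℂ 1` of the multiplier algebra of `A`. -/
def unitalStarSubalgebra : StarSubalgebra ℂ (DoubleCentralizer ℂ A) where
  carrier := {x | ∃ (a : A) (c : ℂ),
    x = DoubleCentralizer.coeHom a + algebraMap ℂ (DoubleCentralizer ℂ A) c}
  mul_mem' := by
    rintro _ _ ⟨a, c, rfl⟩ ⟨b, d, rfl⟩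
    refine ⟨a * b + d • a + c • b, c * d, ?_⟩
    simp only [map_add, map_mul, map_smul, Algebra.algebraMap_eq_smul_one, mul_add, add_mul,
      smul_mul_assoc, mul_smul_comm, one_mul, mul_one, smul_add, smul_smul]
    abel
  one_mem' := ⟨0, 1, by rw [map_zero, map_one, zero_add]⟩
  add_mem' := by
    rintro _ _ ⟨a, c, rfl⟩ ⟨b, d, rfl⟩
    exact ⟨a + b, c + d, by simp only [map_add]; abel⟩
  zero_mem' := ⟨0, 0, by rw [map_zero, map_zero, add_zero]⟩
  algebraMap_mem' c := ⟨0, c, by rw [map_zero, zero_add]⟩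
  star_mem' := by
    rintro _ ⟨a, c, rfl⟩
    exact ⟨star a, star c, by rw [star_add, map_star, algebraMap_star_comm]⟩

/-- The canonical map of `A` into its multiplier algebra is isometric. -/
theorem norm_coeHom (a : A) : ‖(DoubleCentralizer.coeHom a : DoubleCentralizer ℂ A)‖ = ‖a‖ := by
  rw [← DoubleCentralizer.norm_fst]
  exact ContinuousLinearMap.opNorm_mul_apply ℂ A a

theorem isClosed_unitalStarSubalgebra :
    IsClosed (unitalStarSubalgebra A : Set (DoubleCentralizer ℂ A)) := by
  let ι : A →ₗ[ℂ] DoubleCentralizer ℂ A :=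
    { toFun := fun a => DoubleCentralizer.coeHom a
      map_add' := map_add _
      map_smul' := map_smul _ }
  have hι : Isometry ι := AddMonoidHomClass.isometry_of_norm ι (norm_coeHom A)
  have hcl : IsClosed (LinearMap.range ι : Set (DoubleCentralizer ℂ A)) := by
    rw [LinearMap.coe_range]
    exact hι.isClosedEmbedding.isClosed_range
  have h := Submodule.isClosed_sup_finiteDimensional (LinearMap.range ι)
    (Submodule.span ℂ {(1 : DoubleCentralizer ℂ A)}) hcl
  convert h using 1
  ext x
  simp only [SetLike.mem_coe, Submodule.mem_sup, LinearMap.mem_range, Submodule.mem_span_singleton,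
    exists_exists_eq_and]
  constructor
  · rintro ⟨a, c, rfl⟩
    exact ⟨a, c, by rw [Algebra.algebraMap_eq_smul_one]; rfl⟩
  · rintro ⟨a, c, rfl⟩
    exact ⟨a, c, by rw [Algebra.algebraMap_eq_smul_one]; rfl⟩

/-- The smallest unital C⋆-algebra `uA` containing `A`, realised as `A + ℂ 1` inside the multiplier
algebra of `A`. If `A` has a unit then the unit of the multiplier algebra is (the image of) the
unit of `A`, and `uA = A`; otherwise `uA` is the standard unitization `A ⊕ ℂ`. -/
def Unital : Type u := unitalStarSubalgebra A

instance : IsClosed (unitalStarSubalgebra A : Set (DoubleCentralizer ℂ A)) :=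
  isClosed_unitalStarSubalgebra A

instance : CStarAlgebra (Unital A) :=
  inferInstanceAs (CStarAlgebra (unitalStarSubalgebra A))

instance : PartialOrder (Unital A) := CStarAlgebra.spectralOrder _

instance : StarOrderedRing (Unital A) := CStarAlgebra.spectralOrderedRing _

variable {A}

/-- The canonical embedding `A → uA`. -/
def toUnital : A →⋆ₙₐ[ℂ] Unital A :=
  NonUnitalStarAlgHom.codRestrict DoubleCentralizer.coeHom
    (unitalStarSubalgebra A).toNonUnitalStarSubalgebra
    fun a => ⟨a, 0, by rw [map_zero, add_zero]⟩

end Unitization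

section States

variable {A : Type u} [NonUnitalCStarAlgebra A]

variable (A) in
/-- A state of `A`: a positive linear functional of norm one. -/
structure State where
  toDual : StrongDual ℂ A
  nonneg' : ∀ a : A, 0 ≤ toDual (star a * a)
  norm_eq_one' : ‖toDual‖ = 1

theorem State.tendsto_mul_self [PartialOrder A] [StarOrderedRing A] (φ : State A) :
    Tendsto (fun e : A => φ.toDual (e * e)) (CStarAlgebra.approximateUnit A) (𝓝 1) := by
  have hl := CStarAlgebra.increasingApproximateUnit A
  let f : A →ₚ[ℂ] ℂ := PositiveLinearMap.mk₀ φ.toDual.toLinearMap (by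
    intro x hx
    obtain ⟨b, rfl⟩ := CStarAlgebra.nonneg_iff_eq_star_mul_self.mp hx
    exact φ.nonneg' b)
  have hf : ∀ a, f a = φ.toDual a := fun _ => rfl
  have hbd : ∀ a, ‖φ.toDual a‖ ≤ ‖a‖ := fun a => by
    simpa [φ.norm_eq_one'] using φ.toDual.le_opNorm a
  have hCS : ∀ e a : A, star e = e →
      ‖φ.toDual (e * a)‖ ≤ √(φ.toDual (e * e)).re * ‖a‖ := by
    intro e a he
    have h1 := norm_inner_le_norm (𝕜 := ℂ) (f.toPreGNS e) (f.toPreGNS a)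
    rw [f.preGNS_inner_def, f.preGNS_norm_def, f.preGNS_norm_def] at h1
    simp only [f.ofPreGNS_toPreGNS, he, hf] at h1
    refine h1.trans (mul_le_mul_of_nonneg_left ?_ (Real.sqrt_nonneg _))
    rw [Real.sqrt_le_left (norm_nonneg _)]
    calc (φ.toDual (star a * a)).re ≤ ‖φ.toDual (star a * a)‖ := Complex.re_le_norm _
      _ ≤ ‖star a * a‖ := hbd _
      _ = ‖a‖ ^ 2 := by rw [CStarRing.norm_star_mul_self, sq]
  have hre : Tendsto (fun e : A => (φ.toDual (e * e)).re)
      (CStarAlgebra.approximateUnit A) (𝓝 1) := by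
    rw [tendsto_order]
    constructor
    · intro r hr
      have hs : √(max r 0) < ‖φ.toDual‖ := by
        rw [φ.norm_eq_one', Real.sqrt_lt' one_pos]
        simpa using hr
      obtain ⟨a, ha1, ha2⟩ := φ.toDual.exists_lt_apply_of_lt_opNorm hs
      have ht : Tendsto (fun e : A => ‖φ.toDual (e * a)‖) (CStarAlgebra.approximateUnit A)
          (𝓝 ‖φ.toDual a‖) :=
        ((φ.toDual.continuous.tendsto a).comp (hl.tendsto_mul_right a)).norm
      filter_upwards [ht.eventually_const_lt ha2, hl.eventually_star_eq] with e he1 he2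
      have h2 := he1.trans_le (hCS e a he2)
      have h3 : √(max r 0) < √(φ.toDual (e * e)).re :=
        h2.trans_le (mul_le_of_le_one_right (Real.sqrt_nonneg _) ha1.le)
      exact (le_max_left _ _).trans_lt ((Real.sqrt_lt_sqrt_iff (le_max_right _ _)).mp h3)
    · intro r hr
      filter_upwards [hl.eventually_norm] with e he
      calc (φ.toDual (e * e)).re ≤ ‖φ.toDual (e * e)‖ := Complex.re_le_norm _
        _ ≤ ‖e * e‖ := hbd _
        _ ≤ ‖e‖ * ‖e‖ := norm_mul_le _ _
        _ ≤ 1 := mul_le_one₀ he (norm_nonneg _) he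
        _ < r := hr
  have hco : Tendsto (fun e : A => (((φ.toDual (e * e)).re : ℝ) : ℂ))
      (CStarAlgebra.approximateUnit A) (𝓝 1) := by
    simpa [Function.comp_def] using (Complex.continuous_ofReal.tendsto 1).comp hre
  refine hco.congr' ?_
  filter_upwards [hl.eventually_star_eq] with e he
  have := φ.nonneg' e
  rw [he] at this
  exact (Complex.eq_re_of_ofReal_le (r := 0) (by simpa using this)).symm

/-- A state of `A` extends to a positive linear functional on `uA` with value `1` at the unit. -/
theorem State.exists_extension (φ : State A) :
    ∃ ψ : Unital A →ₚ[ℂ] ℂ, ψ 1 = 1 ∧ ∀ a : A, ψ (toUnital a) = φ.toDual a := by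
  let _ : PartialOrder A := CStarAlgebra.spectralOrder A
  have _ : StarOrderedRing A := CStarAlgebra.spectralOrderedRing A
  have hl := CStarAlgebra.increasingApproximateUnit A
  set l := CStarAlgebra.approximateUnit A
  let T : Unital A → A → ℂ := fun x e => φ.toDual (e * x.1.fst e)
  have h1 := φ.tendsto_mul_self
  have h2 : ∀ a : A, Tendsto (fun e : A => φ.toDual (e * (a * e))) l (𝓝 (φ.toDual a)) := by
    intro a
    refine (φ.toDual.continuous.tendsto a).comp ?_
    rw [tendsto_iff_norm_sub_tendsto_zero]
    have ha := tendsto_iff_norm_sub_tendsto_zero.mp (hl.tendsto_mul_left a)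
    have hb := tendsto_iff_norm_sub_tendsto_zero.mp (hl.tendsto_mul_right a)
    refine tendsto_of_tendsto_of_tendsto_of_le_of_le' tendsto_const_nhds
      (by simpa using ha.add hb) (Eventually.of_forall fun _ => norm_nonneg _) ?_
    filter_upwards [hl.eventually_norm] with e he
    calc ‖e * (a * e) - a‖ = ‖e * (a * e - a) + (e * a - a)‖ := by congr 1; rw [mul_sub]; abel
      _ ≤ ‖e * (a * e - a)‖ + ‖e * a - a‖ := norm_add_le _ _
      _ ≤ ‖a * e - a‖ + ‖e * a - a‖ := by
        gcongr
        exact (norm_mul_le _ _).trans (mul_le_of_le_one_left (norm_nonneg _) he)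
  have hT : ∀ (a : A) (c : ℂ) (x : Unital A), x.1 = DoubleCentralizer.coeHom a +
      algebraMap ℂ (DoubleCentralizer ℂ A) c → Tendsto (T x) l (𝓝 (φ.toDual a + c)) := by
    intro a c x hx
    have : T x = fun e => φ.toDual (e * (a * e)) + c * φ.toDual (e * e) := by
      funext e
      simp only [T, hx]
      have : (DoubleCentralizer.coeHom a + algebraMap ℂ (DoubleCentralizer ℂ A) c).fst e
          = a * e + c • e := rfl
      rw [this, mul_add, map_add, mul_smul_comm, map_smul, smul_eq_mul]
    rw [this]
    simpa using (h2 a).add (h1.const_mul c)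
  have hlim : ∀ x : Unital A, Tendsto (T x) l (𝓝 (limUnder l (T x))) := by
    intro x
    obtain ⟨a, c, hx⟩ := x.2
    exact tendsto_nhds_limUnder ⟨_, hT a c x hx⟩
  let g : Unital A →ₗ[ℂ] ℂ :=
    { toFun := fun x => limUnder l (T x)
      map_add' := fun x y => by
        refine tendsto_nhds_unique (hlim (x + y)) (((hlim x).add (hlim y)).congr fun e => ?_)
        change φ.toDual (e * x.1.fst e) + φ.toDual (e * y.1.fst e) =
          φ.toDual (e * (x.1.fst e + y.1.fst e))
        rw [mul_add, map_add]
      map_smul' := fun c x => by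
        refine tendsto_nhds_unique (hlim (c • x)) (((hlim x).const_mul c).congr fun e => ?_)
        change c * φ.toDual (e * x.1.fst e) = φ.toDual (e * (c • x.1.fst e))
        rw [mul_smul_comm, map_smul, smul_eq_mul] }
  refine ⟨PositiveLinearMap.mk₀ g ?_, ?_, ?_⟩
  · intro x hx
    obtain ⟨b, rfl⟩ := CStarAlgebra.nonneg_iff_eq_star_mul_self.mp hx
    refine ge_of_tendsto (hlim (star b * b)) ?_
    filter_upwards [hl.eventually_star_eq] with e he
    have : e * (star b * b : Unital A).1.fst e = star (b.1.fst e) * b.1.fst e := by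
      show e * (star b.1).fst (b.1.fst e) = _
      rw [DoubleCentralizer.star_fst]
      apply star_injective
      rw [star_mul, star_star, he, b.1.central, star_mul, star_star]
    show 0 ≤ φ.toDual (e * (star b * b : Unital A).1.fst e)
    rw [this]
    exact φ.nonneg' _
  · refine tendsto_nhds_unique (hlim 1) ?_
    simpa using hT 0 1 1 (by rw [map_zero, map_one, zero_add]; rfl)
  · intro a
    refine tendsto_nhds_unique (hlim _) ?_
    simpa using hT a 0 (toUnital a) (by rw [map_zero, add_zero]; rfl)

/-- The (unique, because `uA = A + ℂ 1`) extension of a state of `A` to a state of `uA`. -/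
def State.extend (φ : State A) : Unital A →ₚ[ℂ] ℂ := φ.exists_extension.choose

theorem State.extend_one (φ : State A) : φ.extend 1 = 1 := φ.exists_extension.choose_spec.1

theorem State.extend_toUnital (φ : State A) (a : A) : φ.extend (toUnital a) = φ.toDual a :=
  φ.exists_extension.choose_spec.2 a

end States

section DirectSum

variable {ι : Type*} {G : ι → Type*} [∀ i, NormedAddCommGroup (G i)]
  [∀ i, InnerProductSpace ℂ (G i)] [∀ i, CompleteSpace (G i)]
  {B : Type*} [CStarAlgebra B] (ρ : ∀ i, B →⋆ₐ[ℂ] (G i →L[ℂ] G i))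

theorem norm_rep_apply_le (b : B) (i : ι) (x : G i) : ‖ρ i b x‖ ≤ ‖(‖b‖ : ℂ) • x‖ := by
  rw [norm_smul, Complex.norm_real, norm_norm]
  exact (ρ i b).le_of_opNorm_le (NonUnitalStarAlgHom.norm_apply_le (ρ i) b) x

/-- The operator `⨁ᵢ ρᵢ(b)` on the Hilbert space direct sum. -/
def directSumOperator (b : B) : lp G 2 →L[ℂ] lp G 2 :=
  LinearMap.mkContinuous
    { toFun := fun ξ => ⟨fun i => ρ i b (ξ i),
        ((lp.memℓp ξ).const_smul (‖b‖ : ℂ)).mono' fun i => norm_rep_apply_le ρ b i (ξ i)⟩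
      map_add' := fun ξ η => by
        ext i
        exact map_add (ρ i b) (ξ i) (η i)
      map_smul' := fun c ξ => by
        ext i
        exact map_smul (ρ i b) c (ξ i) }
    ‖b‖ fun ξ => by
      have h := lp.norm_mono (E := G) (F := G) (p := 2) two_ne_zero
        (x := ⟨fun i => ρ i b (ξ i),
          ((lp.memℓp ξ).const_smul (‖b‖ : ℂ)).mono' fun i => norm_rep_apply_le ρ b i (ξ i)⟩)
        (y := (‖b‖ : ℂ) • ξ) fun i => norm_rep_apply_le ρ b i (ξ i)
      refine h.trans ((norm_smul_le _ _).trans_eq ?_)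
      rw [Complex.norm_real, norm_norm]

theorem directSumOperator_apply (b : B) (ξ : lp G 2) (i : ι) :
    directSumOperator ρ b ξ i = ρ i b (ξ i) := rfl

/-- The Hilbert space direct sum of a family of unital ⋆-representations. -/
def directSumRep : B →⋆ₐ[ℂ] (lp G 2 →L[ℂ] lp G 2) where
  toFun := directSumOperator ρ
  map_one' := by
    ext ξ i
    simp [directSumOperator_apply]
  map_mul' a b := by
    ext ξ i
    simp [directSumOperator_apply]
  map_zero' := by
    ext ξ i
    simp [directSumOperator_apply]
  map_add' a b := by
    ext ξ i
    simp [directSumOperator_apply]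
  commutes' c := by
    ext ξ i
    rw [directSumOperator_apply, AlgHomClass.commutes]
    rfl
  map_star' a := by
    rw [ContinuousLinearMap.star_eq_adjoint, ContinuousLinearMap.eq_adjoint_iff]
    intro ξ η
    rw [lp.inner_eq_tsum, lp.inner_eq_tsum]
    refine tsum_congr fun i => ?_
    rw [directSumOperator_apply, directSumOperator_apply, map_star,
      ContinuousLinearMap.star_eq_adjoint, ContinuousLinearMap.adjoint_inner_left]

end DirectSum

section UniversalRepresentation

variable {A : Type u} [NonUnitalCStarAlgebra A]

/-- The Hilbert space of the GNS representation of (the extension to `uA` of) a state of `A`. -/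
def State.Space (φ : State A) : Type u := φ.extend.GNS

instance (φ : State A) : NormedAddCommGroup φ.Space :=
  inferInstanceAs (NormedAddCommGroup φ.extend.GNS)

instance (φ : State A) : InnerProductSpace ℂ φ.Space :=
  inferInstanceAs (InnerProductSpace ℂ φ.extend.GNS)

instance (φ : State A) : CompleteSpace φ.Space :=
  inferInstanceAs (CompleteSpace φ.extend.GNS)

/-- The GNS representation of a state. -/
def State.rep (φ : State A) : Unital A →⋆ₐ[ℂ] (φ.Space →L[ℂ] φ.Space) :=
  φ.extend.gnsStarAlgHom

/-- The canonical cyclic vector of the GNS representation of a state. -/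
def State.cyclicVector (φ : State A) : φ.Space :=
  ((φ.extend.toPreGNS 1 : φ.extend.PreGNS) : φ.extend.GNS)

theorem State.inner_cyclicVector (φ : State A) (a : Unital A) :
    ⟪φ.cyclicVector, φ.rep a φ.cyclicVector⟫_ℂ = φ.extend a := by
  change ⟪((φ.extend.toPreGNS 1 : φ.extend.PreGNS) : φ.extend.GNS),
    φ.extend.gnsNonUnitalStarAlgHom a ((φ.extend.toPreGNS 1 : φ.extend.PreGNS) : φ.extend.GNS)⟫_ℂ
    = _
  rw [PositiveLinearMap.gnsNonUnitalStarAlgHom_apply_coe, UniformSpace.Completion.inner_coe,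
    PositiveLinearMap.preGNS_inner_def]
  simp

variable (A) in
/-- The Hilbert space of the universal representation of `A`: the direct sum of the GNS spaces of
all states of `A`. -/
def UniversalSpace : Type u := lp (fun φ : State A => φ.Space) 2

instance : NormedAddCommGroup (UniversalSpace A) :=
  inferInstanceAs (NormedAddCommGroup (lp (fun φ : State A => φ.Space) 2))

instance : InnerProductSpace ℂ (UniversalSpace A) :=
  inferInstanceAs (InnerProductSpace ℂ (lp (fun φ : State A => φ.Space) 2))

instance : CompleteSpace (UniversalSpace A) :=
  inferInstanceAs (CompleteSpace (lp (fun φ : State A => φ.Space) 2))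

/-- The universal representation (extended to `uA`): the direct sum of all GNS representations. -/
def universalRep : Unital A →⋆ₐ[ℂ] (UniversalSpace A →L[ℂ] UniversalSpace A) :=
  directSumRep fun φ : State A => φ.rep

open Classical in
/-- The vector of the universal representation which implements the state `φ`. -/
def State.vector (φ : State A) : UniversalSpace A :=
  lp.single (E := fun φ : State A => φ.Space) 2 φ φ.cyclicVector

/-- The vector state of `φ.vector` extends `φ`. -/
theorem State.inner_vector (φ : State A) (a : Unital A) :
    ⟪φ.vector, universalRep a φ.vector⟫_ℂ = φ.extend a := by
  classical
  have h1 : ⟪φ.vector, universalRep a φ.vector⟫_ℂ =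
      ⟪φ.cyclicVector, φ.rep a (lp.single (E := fun φ : State A => φ.Space) 2 φ
        φ.cyclicVector φ)⟫_ℂ :=
    lp.inner_single_left (𝕜 := ℂ) (G := fun φ : State A => φ.Space) φ φ.cyclicVector
      (directSumOperator (fun φ : State A => φ.rep) a
        (lp.single (E := fun φ : State A => φ.Space) 2 φ φ.cyclicVector))
  rw [h1, lp.single_apply_self, φ.inner_cyclicVector]

end UniversalRepresentation

section Bidual

variable (A : Type u) [NonUnitalCStarAlgebra A]

/-- The enveloping von Neumann algebra `A**` of `A`: the bicommutant of `A` in its universal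
representation. Its norm is the operator norm. -/
def bidual : VonNeumannAlgebra (UniversalSpace A) where
  toStarSubalgebra := StarSubalgebra.centralizer ℂ
    (Set.centralizer (Set.range fun a : A => universalRep (toUnital a)))
  centralizer_centralizer' := by
    change Set.centralizer (Set.centralizer (Set.centralizer (_ ∪ star _))) =
      Set.centralizer (_ ∪ star _)
    rw [Set.centralizer_centralizer_centralizer]

variable {A}

theorem coe_bidual : (bidual A : Set (UniversalSpace A →L[ℂ] UniversalSpace A)) =
    Set.centralizer (Set.centralizer (Set.range fun a : A => universalRep (toUnital a))) := by
  have h : star (Set.centralizer (Set.range fun a : A => universalRep (toUnital a))) =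
      Set.centralizer (Set.range fun a : A => universalRep (toUnital a)) := by
    ext T
    rw [Set.mem_star]
    have key : ∀ S : UniversalSpace A →L[ℂ] UniversalSpace A,
        S ∈ Set.centralizer (Set.range fun a : A => universalRep (toUnital a)) →
        star S ∈ Set.centralizer (Set.range fun a : A => universalRep (toUnital a)) := by
      intro S hS
      rw [Set.mem_centralizer_iff] at hS ⊢
      rintro _ ⟨a, rfl⟩
      have := hS _ ⟨star a, rfl⟩
      simp only [map_star] at this
      simpa using (congrArg star this).symm
    exact ⟨fun h => by simpa using key _ h, key T⟩
  change Set.centralizer (_ ∪ star _) = _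
  rw [h, Set.union_self]

theorem universalRep_mem_bidual (a : Unital A) : universalRep a ∈ bidual A := by
  rw [← SetLike.mem_coe, coe_bidual]
  obtain ⟨x, b, c, hx⟩ := a
  have : (⟨x, b, c, hx⟩ : Unital A) = toUnital b + algebraMap ℂ (Unital A) c := Subtype.ext hx
  rw [this, map_add, AlgHomClass.commutes]
  rw [Set.mem_centralizer_iff]
  intro T hT
  rw [mul_add, add_mul, Algebra.commutes c T,
    (Set.mem_centralizer_iff.mp hT _ ⟨b, rfl⟩).symm]

/-- The inclusion `uA ⊆ A**`. -/
def toBidual (a : Unital A) : bidual A := ⟨universalRep a, universalRep_mem_bidual a⟩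

/-- The normal state of `A**` which extends the state `φ` of `A`: in the universal representation
it is the vector state given by the canonical cyclic vector of the summand of `φ`. -/
def State.normal (φ : State A) (T : bidual A) : ℂ :=
  ⟪φ.vector, (T : UniversalSpace A →L[ℂ] UniversalSpace A) φ.vector⟫_ℂ

variable (M : NonUnitalStarSubalgebra ℂ A)

/-- The Gel'fand spectrum `σ(M)`, with the weak* topology. -/
abbrev GelfandSpectrum : Type u := WeakDual.characterSpace ℂ M

variable {M}

/-- The range of the spectral projection of a compact (more generally, closed) set `K ⊆ σ(M)`.
The projection `1_{σ(M) ∖ K} ∈ M** ⊆ A**` is the supremum of the `g ∈ M`, `0 ≤ g ≤ 1`, that vanish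
on `K` (regularity of Radon measures on the open set `σ(M) ∖ K`), so its range is the closed span
of the ranges of the `g ∈ M` that vanish on `K`. As `M` acts nondegenerately when it contains an
approximate identity of `A`, the range of `1_K` is the orthogonal complement of that space, i.e.
the common kernel of all `g ∈ M` vanishing on `K`. -/
def carrierSubspace (K : Set (GelfandSpectrum M)) : Submodule ℂ (UniversalSpace A) :=
  ⨅ (g : M) (_ : ∀ χ ∈ K, χ g = 0),
    LinearMap.ker (universalRep (toUnital (g : A))).toLinearMap

theorem mem_carrierSubspace {K : Set (GelfandSpectrum M)} {ξ : UniversalSpace A} :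
    ξ ∈ carrierSubspace K ↔
      ∀ g : M, (∀ χ ∈ K, χ g = 0) → universalRep (toUnital (g : A)) ξ = 0 := by
  simp [carrierSubspace]

theorem isClosed_carrierSubspace (K : Set (GelfandSpectrum M)) :
    IsClosed (carrierSubspace K : Set (UniversalSpace A)) := by
  have : (carrierSubspace K : Set (UniversalSpace A)) =
      ⋂ (g : M) (_ : ∀ χ ∈ K, χ g = 0), {ξ | universalRep (toUnital (g : A)) ξ = 0} := by
    ext ξ
    simp [mem_carrierSubspace]
  rw [this]
  exact isClosed_iInter fun g => isClosed_iInter fun _ =>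
    isClosed_eq (universalRep (toUnital (g : A))).continuous continuous_const

instance (K : Set (GelfandSpectrum M)) : CompleteSpace (carrierSubspace K) :=
  (isClosed_carrierSubspace K).completeSpace_coe

/-- The projection onto this space lies in `A**`. -/
theorem starProjection_mem_bidual (K : Set (GelfandSpectrum M)) :
    (carrierSubspace K).starProjection ∈ bidual A := by
  rw [VonNeumannAlgebra.IsStarProjection.mem_iff isStarProjection_starProjection]
  intro T hT
  rw [VonNeumannAlgebra.mem_commutant_iff] at hT
  rw [Module.End.mem_invtSubmodule]
  intro ξ hξ
  rw [Submodule.range_starProjection] at hξ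
  rw [Submodule.mem_comap, Submodule.range_starProjection]
  rw [mem_carrierSubspace] at hξ ⊢
  intro g hg
  have h := congrArg (fun S : UniversalSpace A →L[ℂ] UniversalSpace A => S ξ)
    (hT _ (universalRep_mem_bidual (toUnital (g : A))))
  simpa [hξ g hg] using h

/-- The indicator function `1_K` of a compact set `K ⊆ σ(M)`, as a projection of
`M** ⊆ A**`; for every state `φ` of `A`, the number `φ(1_K)` is the mass of `K` for the Radon
measure on `σ(M)` which represents the restriction of `φ` to `M`. -/
def indicator (K : Set (GelfandSpectrum M)) : bidual A :=
  ⟨(carrierSubspace K).starProjection, starProjection_mem_bidual K⟩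

/-- The element `1_K a 1_K` of `A**`. -/
def corner (K : Set (GelfandSpectrum M)) (a : Unital A) : bidual A :=
  indicator K * toBidual a * indicator K

theorem coe_corner (K : Set (GelfandSpectrum M)) (a : Unital A) :
    (corner K a : UniversalSpace A →L[ℂ] UniversalSpace A) =
      (carrierSubspace K).starProjection * universalRep a * (carrierSubspace K).starProjection :=
  rfl

/-- The seminorm `a ↦ ‖1_K a 1_K‖` on `uA`. -/
def cornerSeminorm (K : Set (GelfandSpectrum M)) : Seminorm ℂ (Unital A) :=
  Seminorm.of (fun a => ‖corner K a‖)
    (fun a b => by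
      have : corner K (a + b) = corner K a + corner K b :=
        Subtype.ext (by
          change _ = (corner K a : UniversalSpace A →L[ℂ] UniversalSpace A) + corner K b
          simp only [coe_corner, map_add, mul_add, add_mul])
      rw [this]
      exact norm_add_le _ _)
    (fun c a => by
      change ‖(corner K (c • a) : UniversalSpace A →L[ℂ] UniversalSpace A)‖ =
        ‖c‖ * ‖(corner K a : UniversalSpace A →L[ℂ] UniversalSpace A)‖
      rw [coe_corner, map_smul, mul_smul_comm, smul_mul_assoc, norm_smul, coe_corner])

/-- The topographic uniform topology: the locally convex topology on `uA` generated by the seminorms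
`a ↦ ‖1_K a 1_K‖`, where `K` ranges over the compact subsets of `σ(M)`. -/
@[reducible]
def topographicUniformTopology (M : NonUnitalStarSubalgebra ℂ A) : TopologicalSpace (Unital A) :=
  SeminormFamily.moduleFilterBasis
    (fun K : TopologicalSpace.Compacts (GelfandSpectrum M) =>
      cornerSeminorm (K : Set (GelfandSpectrum M))) |>.topology

/-- Total boundedness in the topological vector space `uA` with the topographic uniform topology. -/
def IsTopographicTotallyBounded (M : NonUnitalStarSubalgebra ℂ A) (S : Set (Unital A)) : Prop :=
  ∀ U ∈ @nhds (Unital A) (topographicUniformTopology M) 0,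
    ∃ F : Set (Unital A), F.Finite ∧ ∀ a ∈ S, ∃ b ∈ F, a - b ∈ U

/-- The set `S(A|K)` of the states `φ` of `A` with `φ(1_K) = 1`. -/
def stateSpaceOn (K : Set (GelfandSpectrum M)) : Set (State A) :=
  {φ | φ.normal (indicator K) = 1}

/-- The local state space `S(A|M)`: the union of the `S(A|K)` over the compact sets `K ⊆ σ(M)`. -/
def localStates (M : NonUnitalStarSubalgebra ℂ A) : Set (State A) :=
  ⋃ K : TopologicalSpace.Compacts (GelfandSpectrum M), stateSpaceOn (K : Set (GelfandSpectrum M))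

end Bidual

section Lipschitz

variable (A : Type u) [NonUnitalCStarAlgebra A]

/-- A Lipschitz pair `(A, L)`: a seminorm `L` on a dense real subspace of the self-adjoint part of
`uA` with `{a | L(a) = 0} = ℝ 1`. Off its domain, `L` takes the value `∞`. -/
structure LipschitzPair where
  domain : Submodule ℝ (selfAdjoint (Unital A))
  seminorm : Seminorm ℝ domain
  dense_domain : Dense (domain : Set (selfAdjoint (Unital A)))
  setOf_eq_zero : {a : selfAdjoint (Unital A) | ∃ h : a ∈ domain, seminorm ⟨a, h⟩ = 0} =
    Set.range fun r : ℝ => r • (1 : selfAdjoint (Unital A))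

variable {A}

/-- `(A, M)` is a topographic quantum space: `M` is an Abelian C⋆-subalgebra of `A` which contains
an approximate identity for `A`. -/
structure IsTopography (M : NonUnitalStarSubalgebra ℂ A) : Prop where
  isClosed : IsClosed (M : Set A)
  mul_comm : ∀ x ∈ M, ∀ y ∈ M, x * y = y * x
  exists_approximateUnit : ∃ l : Filter A, l.IsApproximateUnit ∧ (M : Set A) ∈ l

variable (A) in
/-- A Lipschitz triple `(A, L, M)`. -/
structure LipschitzTriple extends LipschitzPair A where
  topography : NonUnitalStarSubalgebra ℂ A
  isTopography : IsTopography topography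

/-- The set of the self-adjoint `a ∈ uA` with `L(a) ≤ 1`. -/
def LipschitzPair.unitBall (P : LipschitzPair A) : Set (selfAdjoint (Unital A)) :=
  {a | ∃ h : a ∈ P.domain, P.seminorm ⟨a, h⟩ ≤ 1}

/-- The set `L₁(A, L, μ)` of the self-adjoint `a ∈ uA` with `L(a) ≤ 1` and `μ(a) = 0`. -/
def LipschitzPair.ballAt (P : LipschitzPair A) (μ : State A) : Set (Unital A) :=
  {x | ∃ a ∈ P.unitBall, (a : Unital A) = x ∧ μ.extend x = 0}

/-- The inclusion of the self-adjoint part of `A` in the self-adjoint part of `uA`. -/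
def selfAdjointToUnital (a : selfAdjoint A) : selfAdjoint (Unital A) :=
  ⟨toUnital (a : A), by
    rw [selfAdjoint.mem_iff, ← map_star, selfAdjoint.mem_iff.mp a.2]⟩

/-- The extended Monge-Kantorovich metric on the state space of `A`. -/
def LipschitzPair.kantorovich (P : LipschitzPair A) (φ ψ : State A) : ℝ≥0∞ :=
  ⨆ (a : selfAdjoint A) (_ : selfAdjointToUnital a ∈ P.unitBall),
    ‖φ.toDual (a : A) - ψ.toDual (a : A)‖ₑ

/-- The extended Monge-Kantorovich metric as an extended (pseudo)metric structure; it induces the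
metric topology on the state space. -/
@[reducible]
def LipschitzPair.kantorovichEMetric (P : LipschitzPair A) : PseudoEMetricSpace (State A) where
  edist := P.kantorovich
  edist_self φ := by simp [LipschitzPair.kantorovich]
  edist_comm φ ψ := by
    simp only [LipschitzPair.kantorovich]
    exact iSup_congr fun a => iSup_congr fun _ => by rw [← enorm_neg, neg_sub]
  edist_triangle φ ψ χ := by
    refine iSup₂_le fun a ha => ?_
    calc ‖φ.toDual (a : A) - χ.toDual (a : A)‖ₑ
        = ‖(φ.toDual (a : A) - ψ.toDual (a : A)) + (ψ.toDual (a : A) - χ.toDual (a : A))‖ₑ := by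
          rw [sub_add_sub_cancel]
      _ ≤ ‖φ.toDual (a : A) - ψ.toDual (a : A)‖ₑ + ‖ψ.toDual (a : A) - χ.toDual (a : A)‖ₑ :=
          enorm_add_le _ _
      _ ≤ P.kantorovich φ ψ + P.kantorovich ψ χ := by
          gcongr
          · exact le_iSup₂_of_le a ha le_rfl
          · exact le_iSup₂_of_le a ha le_rfl

variable (A) in
/-- The weak* topology `σ(A*, A)` on the state space of `A`. -/
@[reducible]
def weakStarTopology : TopologicalSpace (State A) :=
  TopologicalSpace.induced (fun φ : State A => StrongDual.toWeakDual φ.toDual) inferInstance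

namespace LipschitzTriple

variable (T : LipschitzTriple A)

/-- The set `𝒦` of states is `(A, L, M)`-tame. -/
def IsTame (𝒦 : Set (State A)) : Prop :=
  ∃ μ ∈ localStates T.topography,
    Tendsto (fun K : TopologicalSpace.Compacts (GelfandSpectrum T.topography) =>
      ⨆ (a : Unital A) (_ : a ∈ T.ballAt μ) (φ : State A) (_ : φ ∈ 𝒦),
        ‖φ.normal (toBidual a - corner (K : Set (GelfandSpectrum T.topography)) a)‖ₑ)
      atTop (𝓝 0)

/-- Each `S(A|K)`, for `K ⊆ σ(M)` compact, has finite diameter for the Monge-Kantorovich metric. -/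
def IsRegular : Prop :=
  ∀ K : TopologicalSpace.Compacts (GelfandSpectrum T.topography),
    (⨆ (φ : State A) (_ : φ ∈ stateSpaceOn (K : Set (GelfandSpectrum T.topography)))
      (ψ : State A) (_ : ψ ∈ stateSpaceOn (K : Set (GelfandSpectrum T.topography))),
      T.kantorovich φ ψ) < ∞

/-- `(A, L, M)` is a quantum locally compact metric space: it is regular and, on each tame set of
states, the Monge-Kantorovich metric induces the weak* topology. -/
def IsQuantumLocallyCompactMetricSpace : Prop :=
  T.IsRegular ∧ ∀ 𝒦 : Set (State A), T.IsTame 𝒦 →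
    TopologicalSpace.induced ((↑) : 𝒦 → State A)
        T.kantorovichEMetric.toUniformSpace.toTopologicalSpace =
      TopologicalSpace.induced ((↑) : 𝒦 → State A) (weakStarTopology A)

end LipschitzTriple

end Lipschitz

end QuantumMetric

end

/-! The theorem is an Arzelà–Ascoli statement on the state spaces S(A|K). For self-adjoint `a`, the
norm of 1_K a 1_K is the supremum of |φ(a)| over φ in S(A|K), or 0 if there are none. The upper
bound (`IsTopography.norm_corner_le`) holds because unit vectors in the range of 1_K give such
states and the norm of a self-adjoint operator is a supremum of Rayleigh quotients. The lower bound
is `State.norm_extend_le_norm_corner`. Hence total boundedness of 1_K L₁ 1_K means uniform total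
boundedness of L₁ as a set of functions on S(A|K).

From the metric to nets: S(A|K) is weak* compact (an element of M equal to 1 on K prevents loss of
mass) and tame, hence compact for the Monge–Kantorovich metric. The functions in L₁ are 1-Lipschitz
for that metric and, vanishing at a base state that may be assumed to lie in S(A|K), are bounded by
its finite diameter. Evaluation at a finite net of states leaves a bounded subset of ℂⁿ.

From nets to the metric: a net at scale 1 bounds the diameter. On a tame set, φ(a) is uniformly
close to φ(1_K a 1_K) for one K, so weak* closeness on a finite net of elements forces metric
closeness. That the metric topology refines the weak* topology holds on all states, by density of
the domain of L.

Topographic total boundedness reduces to one compact set at a time since compact sets are directed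
(`isTopographicTotallyBounded_iff`). The base state can be changed by enlarging K to carry the new
one, and a local state exists by Hahn–Banach extension of a character of M. -/

noncomputable section

namespace QuantumMetric

open Filter Topology
open scoped ENNReal ComplexOrder InnerProductSpace

universe u


/-! ### Characters of M and Urysohn functions -/

section Characters

variable {A : Type u} [NonUnitalCStarAlgebra A] {M : NonUnitalStarSubalgebra ℂ A}

/-- A character of a closed star subalgebra preserves the involution. -/
theorem character_map_star (hM : IsClosed (M : Set A)) (χ : GelfandSpectrum M) (m : M) :
    χ (star m) = star (χ m) := by
  -- Characters of the unital C⋆-algebra obtained by adjoining a unit to M are automatically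
  -- involutive.
  let χ' : Unitization ℂ M →ₐ[ℂ] ℂ := Unitization.lift (WeakDual.CharacterSpace.toNonUnitalAlgHom χ)
  have h := WeakDual.Complex.instStarHomClass.map_star χ' (m : Unitization ℂ M)
  rw [← Unitization.inr_star] at h
  simpa [χ'] using h

/-- A compact set of characters is dominated by a self-adjoint element with nonnegative
transform. -/
theorem exists_isSelfAdjoint_one_le (hM : IsClosed (M : Set A)) {K : Set (GelfandSpectrum M)}
    (hK : IsCompact K) :
    ∃ h : M, IsSelfAdjoint h ∧ (∀ χ : GelfandSpectrum M, 0 ≤ (χ h).re) ∧ ∀ χ ∈ K, 1 ≤ (χ h).re := by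
  refine hK.induction_on (p := fun K => ∃ h : M, IsSelfAdjoint h ∧
    (∀ χ : GelfandSpectrum M, 0 ≤ (χ h).re) ∧ ∀ χ ∈ K, 1 ≤ (χ h).re) ?_ ?_ ?_ ?_
  · exact ⟨0, .zero _, fun χ => by simp, by simp⟩
  · rintro s t hst ⟨h, h1, h2, h3⟩
    exact ⟨h, h1, h2, fun χ hχ => h3 χ (hst hχ)⟩
  · rintro s t ⟨h, h1, h2, h3⟩ ⟨k, k1, k2, k3⟩
    refine ⟨h + k, h1.add k1, fun χ => ?_, fun χ hχ => ?_⟩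
    · rw [map_add, Complex.add_re]
      exact add_nonneg (h2 χ) (k2 χ)
    · rw [map_add, Complex.add_re]
      have := h2 χ
      have := k2 χ
      rcases hχ with hχ | hχ
      · have := h3 χ hχ
        linarith
      · have := k3 χ hχ
        linarith
  · intro χ₀ _
    obtain ⟨m, hm⟩ : ∃ m, χ₀ m ≠ 0 := by
      by_contra! h0
      exact χ₀.2.1 (ContinuousLinearMap.ext h0)
    have hval : ∀ (χ : GelfandSpectrum M) (r : ℝ),
        (χ ((r : ℂ) • (star m * m))).re = r * ‖χ m‖ ^ 2 := by
      intro χ r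
      rw [map_smul, map_mul, character_map_star hM, smul_eq_mul, Complex.star_def,
        mul_comm ((starRingEnd ℂ) _),
        Complex.mul_conj, Complex.normSq_eq_norm_sq, ← Complex.ofReal_mul, Complex.ofReal_re]
    have hc : (0 : ℝ) < ‖χ₀ m‖ ^ 2 := by positivity
    -- With this scaling the transform of r m*m is 2 at χ₀, so it stays above 1 on a neighbourhood.
    set r : ℝ := 2 / ‖χ₀ m‖ ^ 2 with hr
    have hcont : Continuous fun χ : GelfandSpectrum M => ‖χ m‖ ^ 2 :=
      (((WeakDual.eval_continuous m).comp continuous_subtype_val).norm).pow 2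
    refine ⟨{χ | 1 < r * ‖χ m‖ ^ 2}, mem_nhdsWithin_of_mem_nhds
      ((isOpen_lt continuous_const (continuous_const.mul hcont)).mem_nhds ?_),
      (r : ℂ) • (star m * m), ?_, fun χ => ?_, fun χ hχ => ?_⟩
    · show 1 < r * ‖χ₀ m‖ ^ 2
      rw [hr, div_mul_cancel₀ _ hc.ne']
      norm_num
    · exact IsSelfAdjoint.smul (Complex.conj_ofReal r) (.star_mul_self m)
    · rw [hval]
      positivity
    · rw [hval]
      exact le_of_lt hχ

/-- The truncation of the real line to `[0, 1]`. -/
def truncation (t : ℝ) : ℝ := max 0 (min t 1)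

theorem continuous_truncation : Continuous truncation := by
  unfold truncation
  fun_prop

theorem truncation_zero : truncation 0 = 0 := by simp [truncation]

/-- A compact set of characters admits a Urysohn function in the subalgebra. -/
theorem exists_urysohn (hM : IsClosed (M : Set A)) {K : Set (GelfandSpectrum M)}
    (hK : IsCompact K) :
    ∃ g : M, ‖(g : A)‖ ≤ 1 ∧ ‖(1 : Unital A) - (2 : ℝ) • toUnital (g : A)‖ ≤ 1 ∧
      ∀ χ ∈ K, χ g = 1 := by
  obtain ⟨h, h1, -, h3⟩ := exists_isSelfAdjoint_one_le hM hK
  have hc := continuous_truncation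
  have h0 := truncation_zero
  have hbd : ∀ t, 0 ≤ truncation t ∧ truncation t ≤ 1 := fun t => by simp [truncation]
  -- The truncation vanishes at 0, so the nonunital calculus stays inside M, and it is 1 on [1, ∞),
  -- which contains the values of `h` on K. The bound ‖1 - 2g‖ ≤ 1 records 0 ≤ g ≤ 1 in the form
  -- needed for the Hahn–Banach argument.
  refine ⟨cfcₙ truncation h, ?_, ?_, fun χ hχ => ?_⟩
  · change ‖cfcₙ truncation h‖ ≤ 1
    refine norm_cfcₙ_le fun x _ => ?_
    rw [Real.norm_eq_abs, abs_le]
    constructor <;> linarith [hbd x]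
  · let ι : M →⋆ₙₐ[ℂ] Unital A := (toUnital (A := A)).comp (NonUnitalStarSubalgebraClass.subtype M)
    have hι : ∀ m : M, ι m = toUnital (m : A) := fun _ => rfl
    have hcont : Continuous ι := by
      have : ContinuousLinearMapClass (M →⋆ₙₐ[ℂ] Unital A) ℂ M (Unital A) :=
        NonUnitalStarAlgHom.instContinuousLinearMapClassComplex
      exact map_continuous ι
    have hsa : IsSelfAdjoint (ι h) := h1.map ι
    rw [← hι, NonUnitalStarAlgHomClass.map_cfcₙ ι truncation h, cfcₙ_eq_cfc]
    have : (1 : Unital A) - (2 : ℝ) • cfc truncation (ι h) =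
        cfc (fun t => 1 - 2 * truncation t) (ι h) := by
      rw [cfc_sub .., cfc_const_one .., cfc_const_mul ..]
    rw [this]
    refine norm_cfc_le zero_le_one fun x _ => ?_
    rw [Real.norm_eq_abs, abs_le]
    constructor <;> linarith [hbd x]
  · let ψ : M →⋆ₙₐ[ℂ] ℂ :=
      { WeakDual.CharacterSpace.toNonUnitalAlgHom χ with
        map_star' := character_map_star hM χ }
    have hψ : ∀ m, ψ m = χ m := fun _ => rfl
    have hcont : Continuous ψ := map_continuous χ
    have hsa : IsSelfAdjoint (ψ h) := h1.map ψ
    rw [← hψ, NonUnitalStarAlgHomClass.map_cfcₙ ψ truncation h, cfcₙ_eq_cfc]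
    have hre : ψ h = algebraMap ℝ ℂ (ψ h).re := (Complex.conj_eq_iff_re.mp hsa).symm
    rw [hre, cfc_algebraMap]
    have := h3 χ hχ
    rw [← hψ] at this
    simp [truncation, this]

end Characters


/-! ### Nondegeneracy of the universal representation and the range of 1_K -/

section Representation

theorem norm_eq_one_of_inner_self {H : Type*} [NormedAddCommGroup H] [InnerProductSpace ℂ H]
    {v : H} (h : ⟪v, v⟫_ℂ = 1) : ‖v‖ = 1 := by
  have h' : ‖v‖ ^ 2 = 1 := by
    rw [@norm_sq_eq_re_inner ℂ, h]
    simp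
  exact (pow_eq_one_iff_of_nonneg (norm_nonneg _) two_ne_zero).mp h'

variable {A : Type u} [NonUnitalCStarAlgebra A]

theorem norm_toUnital (a : A) : ‖toUnital a‖ = ‖a‖ := norm_coeHom A a

theorem exists_eq_toUnital_add (x : Unital A) :
    ∃ (b : A) (c : ℂ), x = toUnital b + algebraMap ℂ (Unital A) c := by
  obtain ⟨x, b, c, hx⟩ := x
  exact ⟨b, c, Subtype.ext hx⟩

theorem norm_universalRep_le (a : Unital A) : ‖universalRep a‖ ≤ ‖a‖ :=
  NonUnitalStarAlgHom.norm_apply_le universalRep a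

theorem State.norm_vector (φ : State A) : ‖φ.vector‖ = 1 := by
  have h := φ.inner_vector 1
  rw [φ.extend_one, map_one, one_apply_eq_self] at h
  exact norm_eq_one_of_inner_self h

theorem State.normal_toBidual (φ : State A) (a : Unital A) : φ.normal (toBidual a) = φ.extend a :=
  φ.inner_vector a

theorem State.norm_normal_le (φ : State A) (T : bidual A) : ‖φ.normal T‖ ≤ ‖T‖ := by
  calc ‖φ.normal T‖ ≤ ‖φ.vector‖ * ‖(T : UniversalSpace A →L[ℂ] UniversalSpace A) φ.vector‖ :=
        norm_inner_le_norm _ _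
    _ ≤ ‖φ.vector‖ * (‖T‖ * ‖φ.vector‖) := by
        gcongr
        exact ContinuousLinearMap.le_opNorm _ _
    _ = ‖T‖ := by rw [φ.norm_vector, one_mul, mul_one]

theorem State.norm_extend_le (φ : State A) (a : Unital A) : ‖φ.extend a‖ ≤ ‖a‖ := by
  rw [← φ.normal_toBidual]
  exact (φ.norm_normal_le _).trans (norm_universalRep_le a)

theorem State.norm_vector_rep_sq (φ : State A) (a : Unital A) :
    ((‖universalRep a φ.vector‖ ^ 2 : ℝ) : ℂ) = φ.extend (star a * a) := by
  rw [← φ.inner_vector, map_mul, map_star, mul_apply_eq_comp,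
    ContinuousLinearMap.star_eq_adjoint, ContinuousLinearMap.adjoint_inner_right,
    inner_self_eq_norm_sq_to_K]
  simp

/-- The GNS representation of a state is nondegenerate on the nonunital algebra. -/
theorem State.eq_zero_of_rep_toUnital_apply_eq_zero (φ : State A) (w : φ.Space)
    (hw : ∀ a : A, φ.rep (toUnital a) w = 0) : w = 0 := by
  let _ : PartialOrder A := CStarAlgebra.spectralOrder A
  have _ : StarOrderedRing A := CStarAlgebra.spectralOrderedRing A
  have hl := CStarAlgebra.increasingApproximateUnit A
  have hne := hl.neBot
  have hperp : ∀ (a : A) (v : φ.Space), ⟪w, φ.rep (toUnital a) v⟫_ℂ = 0 := by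
    intro a v
    rw [← ContinuousLinearMap.adjoint_inner_left, ← ContinuousLinearMap.star_eq_adjoint,
      ← map_star, ← map_star, hw, inner_zero_left]
  -- For the cyclic vector Ω, ‖π(e²)Ω - Ω‖² ≤ 2 - 2 Re φ(e²) → 0 along the approximate unit, so Ω is
  -- a limit of vectors orthogonal to `w`. Since Ω is cyclic for uA, orthogonality then spreads to
  -- the whole space.
  have hΩ : ⟪w, φ.cyclicVector⟫_ℂ = 0 := by
    have hnorm : Tendsto (fun e : A => ‖φ.rep (toUnital (e * e)) φ.cyclicVector
        - φ.cyclicVector‖ ^ 2) (CStarAlgebra.approximateUnit A) (𝓝 0) := by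
      have h1 : Tendsto (fun e : A => 2 - 2 * (φ.toDual (e * e)).re)
          (CStarAlgebra.approximateUnit A) (𝓝 0) := by
        have := (Complex.continuous_re.tendsto _).comp φ.tendsto_mul_self
        simpa using (this.const_mul 2).const_sub 2
      refine tendsto_of_tendsto_of_tendsto_of_le_of_le' tendsto_const_nhds h1
        (Eventually.of_forall fun _ => by positivity) ?_
      filter_upwards [hl.eventually_norm] with e he
      have hc : ‖φ.cyclicVector‖ = 1 := by
        have h := φ.inner_cyclicVector 1
        rw [φ.extend_one, map_one, one_apply_eq_self] at h
        exact norm_eq_one_of_inner_self h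
      have hle : ‖φ.rep (toUnital (e * e)) φ.cyclicVector‖ ≤ 1 := by
        refine (ContinuousLinearMap.le_opNorm _ _).trans ?_
        rw [hc, mul_one]
        refine (NonUnitalStarAlgHom.norm_apply_le φ.rep _).trans ?_
        rw [norm_toUnital]
        exact (norm_mul_le _ _).trans (mul_le_one₀ he (norm_nonneg _) he)
      rw [norm_sub_sq (𝕜 := ℂ), hc, ← inner_conj_symm, φ.inner_cyclicVector, φ.extend_toUnital]
      have : ‖φ.rep (toUnital (e * e)) φ.cyclicVector‖ ^ 2 ≤ 1 := pow_le_one₀ (norm_nonneg _) hle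
      simp only [RCLike.conj_re, RCLike.re_eq_complex_re]
      linarith
    have h2 : Tendsto (fun e : A => φ.rep (toUnital (e * e)) φ.cyclicVector)
        (CStarAlgebra.approximateUnit A) (𝓝 φ.cyclicVector) := by
      rw [tendsto_iff_norm_sub_tendsto_zero]
      simpa using hnorm.sqrt
    have h3 := (tendsto_const_nhds (x := w)).inner h2 (𝕜 := ℂ)
    simp only [hperp] at h3
    exact tendsto_nhds_unique h3 tendsto_const_nhds
  have hall : ∀ x : Unital A, ⟪w, φ.rep x φ.cyclicVector⟫_ℂ = 0 := by
    intro x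
    obtain ⟨b, c, rfl⟩ := exists_eq_toUnital_add x
    rw [map_add, add_apply, inner_add_right, hperp, AlgHomClass.commutes,
      Algebra.algebraMap_eq_smul_one, smul_apply,
      one_apply_eq_self, inner_smul_right, hΩ, mul_zero, zero_add]
  have hdense : ∀ v : φ.Space, ⟪w, v⟫_ℂ = 0 := by
    intro v
    refine UniformSpace.Completion.induction_on (α := φ.extend.PreGNS)
      (p := fun v : φ.Space => ⟪w, v⟫_ℂ = 0) v
      (isClosed_eq (continuous_const.inner continuous_id) continuous_const) ?_
    intro y
    have h := hall (φ.extend.ofPreGNS y)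
    have he : φ.rep (φ.extend.ofPreGNS y) φ.cyclicVector =
        ((y : φ.extend.PreGNS) : φ.extend.GNS) := by
      change φ.extend.gnsNonUnitalStarAlgHom (φ.extend.ofPreGNS y)
        ((φ.extend.toPreGNS 1 : φ.extend.PreGNS) : φ.extend.GNS) = _
      rw [PositiveLinearMap.gnsNonUnitalStarAlgHom_apply_coe]
      simp
    rwa [he] at h
  exact inner_self_eq_zero.mp (hdense w)

/-- The universal representation is nondegenerate on the nonunital algebra. -/
theorem eq_zero_of_universalRep_toUnital_apply_eq_zero (w : UniversalSpace A)
    (hw : ∀ a : A, universalRep (toUnital a) w = 0) : w = 0 := by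
  refine lp.ext (E := fun φ : State A => φ.Space) (funext fun φ => ?_)
  refine φ.eq_zero_of_rep_toUnital_apply_eq_zero _ fun a => ?_
  exact congrFun (congrArg (fun v : lp (fun φ : State A => φ.Space) 2 =>
    (v : ∀ φ : State A, φ.Space)) (hw a)) φ

variable {M : NonUnitalStarSubalgebra ℂ A}

/-- The universal representation is nondegenerate on a topography. -/
theorem IsTopography.eq_zero_of_apply_eq_zero (hM : IsTopography M) (w : UniversalSpace A)
    (hw : ∀ m : M, universalRep (toUnital (m : A)) w = 0) : w = 0 := by
  obtain ⟨l, hl, hMl⟩ := hM.exists_approximateUnit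
  have hne := hl.neBot
  refine eq_zero_of_universalRep_toUnital_apply_eq_zero w fun a => ?_
  have hcont : Continuous fun x : A => universalRep (toUnital x) w := by
    have h1 : Continuous (toUnital : A → Unital A) :=
      (AddMonoidHomClass.isometry_of_norm (toUnital (A := A)) norm_toUnital).continuous
    have h2 : Continuous (universalRep : Unital A → _) :=
      AddMonoidHomClass.continuous_of_bound (universalRep (A := A)) 1
        fun a => by simpa using norm_universalRep_le a
    exact (h2.comp h1).clm_apply continuous_const
  have ht := (hcont.tendsto a).comp (hl.tendsto_mul_left a)
  refine tendsto_nhds_unique ht (tendsto_const_nhds.congr' ?_)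
  filter_upwards [hMl] with e he
  have := hw ⟨e, he⟩
  simp only [Function.comp_apply, map_mul, mul_apply_eq_comp, this, map_zero]

/-- An element with Gel'fand transform `1` on `K` acts as the identity on the range of `1_K`. -/
theorem IsTopography.apply_eq_self (hM : IsTopography M) {K : Set (GelfandSpectrum M)} {g : M}
    (hg : ∀ χ ∈ K, χ g = 1) {w : UniversalSpace A} (hw : w ∈ carrierSubspace K) :
    universalRep (toUnital (g : A)) w = w := by
  rw [← sub_eq_zero]
  -- The unit need not lie in M, but mg - m does, and it vanishes on K. Hence every `m` in M kills
  -- gw - w, and nondegeneracy applies.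
  refine hM.eq_zero_of_apply_eq_zero _ fun m => ?_
  have h := mem_carrierSubspace.mp hw (m * g - m) fun χ hχ => by
    rw [map_sub, map_mul, hg χ hχ, mul_one, sub_self]
  have : ((m * g - m : M) : A) = m * g - m := rfl
  rw [this, map_sub, map_sub, map_mul, map_mul] at h
  rw [map_sub]
  exact h

theorem carrierSubspace_mono {K K' : Set (GelfandSpectrum M)} (h : K ⊆ K') :
    carrierSubspace K ≤ carrierSubspace K' := fun ξ hξ => by
  rw [mem_carrierSubspace] at hξ ⊢
  exact fun g hg => hξ g fun χ hχ => hg χ (h hχ)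

/-- Equality case for a projection P and a unit vector v: ⟨v, Pv⟩ = 1 forces ‖v - Pv‖² = 1 - 1 - 1 +
1 = 0. -/
theorem mem_stateSpaceOn_iff_vector_mem {K : Set (GelfandSpectrum M)} {φ : State A} :
    φ ∈ stateSpaceOn K ↔ φ.vector ∈ carrierSubspace K := by
  have h1 : φ ∈ stateSpaceOn K ↔
      ⟪φ.vector, (carrierSubspace K).starProjection φ.vector⟫_ℂ = 1 := Iff.rfl
  rw [h1]
  constructor
  · intro h
    have hv : ⟪φ.vector, φ.vector⟫_ℂ = 1 := by
      rw [inner_self_eq_norm_sq_to_K, φ.norm_vector]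
      simp
    have h2 : ⟪(carrierSubspace K).starProjection φ.vector, φ.vector⟫_ℂ = 1 := by
      rw [← inner_conj_symm, h, map_one]
    have h3 : ⟪(carrierSubspace K).starProjection φ.vector,
        (carrierSubspace K).starProjection φ.vector⟫_ℂ = 1 := by
      rw [Submodule.inner_starProjection_left_eq_right,
        Submodule.starProjection_eq_self_iff.mpr (Submodule.starProjection_apply_mem _ _), h]
    have h4 : φ.vector - (carrierSubspace K).starProjection φ.vector = 0 := by
      rw [← inner_self_eq_zero (𝕜 := ℂ), inner_sub_left, inner_sub_right, inner_sub_right, hv, h,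
        h2, h3, sub_self]
    exact Submodule.starProjection_eq_self_iff.mp (sub_eq_zero.mp h4).symm
  · intro h
    rw [Submodule.starProjection_eq_self_iff.mpr h, inner_self_eq_norm_sq_to_K, φ.norm_vector]
    simp

/-- Expresses 1_K through values of the state on A only. These conditions are weak* closed, and they
can be checked on a state built by hand. -/
theorem mem_stateSpaceOn_iff {K : Set (GelfandSpectrum M)} {φ : State A} :
    φ ∈ stateSpaceOn K ↔
      ∀ g : M, (∀ χ ∈ K, χ g = 0) → φ.toDual (star (g : A) * (g : A)) = 0 := by
  rw [mem_stateSpaceOn_iff_vector_mem, mem_carrierSubspace]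
  refine forall₂_congr fun g _ => ?_
  rw [← φ.extend_toUnital, map_mul, map_star, ← φ.norm_vector_rep_sq]
  simp

theorem stateSpaceOn_mono {K K' : Set (GelfandSpectrum M)} (h : K ⊆ K') :
    stateSpaceOn K ⊆ stateSpaceOn K' := fun φ hφ => by
  rw [mem_stateSpaceOn_iff_vector_mem] at hφ ⊢
  exact carrierSubspace_mono h hφ

theorem State.normal_corner {K : Set (GelfandSpectrum M)} {φ : State A} (hφ : φ ∈ stateSpaceOn K)
    (a : Unital A) : φ.normal (corner K a) = φ.extend a := by
  have h := Submodule.starProjection_eq_self_iff.mpr (mem_stateSpaceOn_iff_vector_mem.mp hφ)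
  rw [← φ.inner_vector, State.normal, coe_corner, mul_apply_eq_comp,
    mul_apply_eq_comp, ← Submodule.inner_starProjection_left_eq_right, h]

end Representation


/-! ### Construction and compactness of local states -/

section LocalStates

theorem norm_one_le_one (B : Type*) [CStarAlgebra B] : ‖(1 : B)‖ ≤ 1 := by
  rcases subsingleton_or_nontrivial B with h | h
  · rw [Subsingleton.elim (1 : B) 0, norm_zero]
    exact zero_le_one
  · exact norm_one.le

/-- A contractive functional on a unital C⋆-algebra with value `1` at the unit is positive. -/
theorem nonneg_of_norm_le_one {B : Type*} [CStarAlgebra B] (f : StrongDual ℂ B) (hf : ‖f‖ ≤ 1)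
    (h1 : f 1 = 1) (b : B) : 0 ≤ f (star b * b) := by
  let _ : PartialOrder B := CStarAlgebra.spectralOrder B
  have _ : StarOrderedRing B := CStarAlgebra.spectralOrderedRing B
  have hle : ∀ x, ‖f x‖ ≤ ‖x‖ := fun x =>
    (f.le_opNorm x).trans (mul_le_of_le_one_left (norm_nonneg _) hf)
  have hreal : ∀ a : B, IsSelfAdjoint a → (f a).im = 0 := by
    intro a ha
    -- Compare `f` with the norm at a + it: the imaginary part of the value is Im f(a) + t, while ‖a
    -- + it‖² ≤ ‖a‖² + t². The t² terms cancel, leaving a bound on an affine function of t.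
    have key : ∀ t : ℝ, 2 * (f a).im * t + (f a).im ^ 2 ≤ ‖a‖ ^ 2 := by
      intro t
      have e1 : ‖a + (t * Complex.I) • (1 : B)‖ ^ 2 ≤ ‖a‖ ^ 2 + t ^ 2 := by
        rw [sq, ← CStarRing.norm_star_mul_self]
        have : star (a + (t * Complex.I) • (1 : B)) * (a + (t * Complex.I) • (1 : B)) =
            a * a + ((t ^ 2 : ℝ) : ℂ) • (1 : B) := by
          rw [star_add, star_smul, star_one, ha.star_eq]
          have hs : star (t * Complex.I : ℂ) = -(t * Complex.I) := by simp
          have hs2 : ((t ^ 2 : ℝ) : ℂ) = -(t * Complex.I) * (t * Complex.I) := by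
            rw [neg_mul, mul_mul_mul_comm, Complex.I_mul_I]
            push_cast
            ring
          rw [hs, hs2]
          generalize (t * Complex.I : ℂ) = s
          simp only [add_mul, mul_add, smul_mul_assoc, mul_smul_comm, one_mul, mul_one]
          module
        rw [this]
        refine (norm_add_le _ _).trans (add_le_add ?_ ?_)
        · rw [sq]
          exact norm_mul_le _ _
        · rw [norm_smul, Complex.norm_real, Real.norm_of_nonneg (sq_nonneg t)]
          exact mul_le_of_le_one_right (sq_nonneg t) (norm_one_le_one B)
      have e2 : ((f a).im + t) ^ 2 ≤ ‖f (a + (t * Complex.I) • (1 : B))‖ ^ 2 := by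
        have : (f (a + (t * Complex.I) • (1 : B))).im = (f a).im + t := by
          rw [map_add, map_smul, h1]
          simp
        rw [← this, ← sq_abs]
        gcongr
        exact Complex.abs_im_le_norm _
      have e3 := pow_le_pow_left₀ (norm_nonneg _) (hle (a + (t * Complex.I) • (1 : B))) 2
      nlinarith
    by_contra hne
    -- This t makes the linear term equal to ‖a‖², which leaves (Im f(a))² ≤ 0.
    have := key (‖a‖ ^ 2 / (2 * (f a).im))
    rw [mul_div_cancel₀ _ (by simpa using hne)] at this
    have : 0 < (f a).im ^ 2 := by positivity
    linarith
  have hsa := IsSelfAdjoint.star_mul_self b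
  have hpos : (0 : B) ≤ star b * b := star_mul_self_nonneg b
  set a := star b * b
  -- As 0 ≤ a, the element ‖a‖ - a has norm at most ‖a‖. Applying `f` puts Re f(a) within ‖a‖ of
  -- ‖a‖, hence at or above 0.
  have e1 : ‖algebraMap ℝ B ‖a‖ - a‖ ≤ ‖a‖ := by
    have h0 : 0 ≤ algebraMap ℝ B ‖a‖ - a := sub_nonneg.mpr hsa.le_algebraMap_norm_self
    have h2 : algebraMap ℝ B ‖a‖ - a ≤ algebraMap ℝ B ‖a‖ := sub_le_self _ hpos
    exact (CStarAlgebra.norm_le_iff_le_algebraMap _ (norm_nonneg _) h0).mpr h2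
  have e2 := (Complex.abs_re_le_norm _).trans ((hle _).trans e1)
  have e3 : f (algebraMap ℝ B ‖a‖) = ((‖a‖ : ℝ) : ℂ) := by
    rw [Algebra.algebraMap_eq_smul_one, ← Complex.coe_smul, map_smul, h1, smul_eq_mul, mul_one]
  rw [map_sub, e3, Complex.sub_re, Complex.ofReal_re, abs_le] at e2
  rw [Complex.nonneg_iff]
  exact ⟨by linarith, (hreal a hsa).symm⟩

variable {A : Type u} [NonUnitalCStarAlgebra A]

theorem State.extend_toUnital_add (φ : State A) (b : A) (c : ℂ) :
    φ.extend (toUnital b + algebraMap ℂ (Unital A) c) = φ.toDual b + c := by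
  rw [map_add, φ.extend_toUnital, Algebra.algebraMap_eq_smul_one, map_smul, φ.extend_one,
    smul_eq_mul, mul_one]

/-- The inclusion of `A` in `uA` as a continuous linear map. -/
def toUnitalL (A : Type u) [NonUnitalCStarAlgebra A] : A →L[ℂ] Unital A :=
  LinearMap.mkContinuous
    { toFun := toUnital
      map_add' := map_add _
      map_smul' := map_smul _ } 1 fun a => by
    rw [one_mul]
    exact (norm_toUnital a).le

theorem toUnitalL_apply (a : A) : toUnitalL A a = toUnital a := rfl

/-- A positive functional of norm at most one is a state as soon as it has the value `1`
somewhere in the unit ball. -/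
def State.ofApplyEqOne (f : StrongDual ℂ A) (hf : ∀ a, 0 ≤ f (star a * a)) (hn : ‖f‖ ≤ 1) {g : A}
    (hg : ‖g‖ ≤ 1) (h1 : f g = 1) : State A where
  toDual := f
  nonneg' := hf
  norm_eq_one' := hn.antisymm <| by
    have := f.le_opNorm g
    rw [h1, norm_one] at this
    exact this.trans (mul_le_of_le_one_right (norm_nonneg _) hg)

variable {M : NonUnitalStarSubalgebra ℂ A}

/-- Unit vectors in the range of `1_K` give states in `S(A|K)`. -/
theorem IsTopography.exists_state_of_mem_carrierSubspace (hM : IsTopography M)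
    {K : Set (GelfandSpectrum M)} (hK : IsCompact K) {ξ : UniversalSpace A}
    (hξ : ξ ∈ carrierSubspace K) (h1 : ‖ξ‖ = 1) :
    ∃ φ ∈ stateSpaceOn K, ∀ a, φ.extend a = ⟪ξ, universalRep a ξ⟫_ℂ := by
  -- Restricting a vector functional to the nonunital A could lower its norm. Here `g` fixes ξ, so
  -- the norm 1 is attained at `g`.
  obtain ⟨g, hg1, -, hgK⟩ := exists_urysohn hM.isClosed hK
  have hξξ : ⟪ξ, ξ⟫_ℂ = 1 := by
    rw [inner_self_eq_norm_sq_to_K, h1]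
    simp
  let f : StrongDual ℂ A := LinearMap.mkContinuous
    { toFun := fun a => ⟪ξ, universalRep (toUnital a) ξ⟫_ℂ
      map_add' := fun a b => by rw [map_add, map_add, add_apply, inner_add_right]
      map_smul' := fun c a => by
        rw [map_smul, map_smul, smul_apply, inner_smul_right]
        rfl } 1 fun a => by
    refine (norm_inner_le_norm (𝕜 := ℂ) ξ (universalRep (toUnital a) ξ)).trans ?_
    rw [h1, one_mul, one_mul]
    refine (ContinuousLinearMap.le_opNorm _ _).trans ?_
    rw [h1, mul_one, ← norm_toUnital a]
    exact norm_universalRep_le _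
  have hf : ∀ a, f a = ⟪ξ, universalRep (toUnital a) ξ⟫_ℂ := fun _ => rfl
  have hpos : ∀ a, f (star a * a) = ((‖universalRep (toUnital a) ξ‖ ^ 2 : ℝ) : ℂ) := by
    intro a
    rw [hf, map_mul, map_star, map_mul, map_star, mul_apply_eq_comp,
      ContinuousLinearMap.star_eq_adjoint, ContinuousLinearMap.adjoint_inner_right,
      inner_self_eq_norm_sq_to_K]
    simp
  let φ : State A := State.ofApplyEqOne f
    (fun a => by
      rw [hpos]
      exact_mod_cast sq_nonneg ‖universalRep (toUnital a) ξ‖)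
    (LinearMap.mkContinuous_norm_le _ zero_le_one _) hg1
    (by rw [hf, hM.apply_eq_self hgK hξ, hξξ])
  have hφ : φ.toDual = f := rfl
  refine ⟨φ, mem_stateSpaceOn_iff.mpr fun m hm => ?_, fun a => ?_⟩
  · rw [hφ, hpos, mem_carrierSubspace.mp hξ m hm]
    simp
  · obtain ⟨b, c, rfl⟩ := exists_eq_toUnital_add a
    rw [φ.extend_toUnital_add, hφ, hf, map_add, add_apply, inner_add_right, AlgHomClass.commutes,
      Algebra.algebraMap_eq_smul_one, smul_apply, one_apply_eq_self, inner_smul_right, hξξ, mul_one]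

/-- The norm of `1_K a 1_K`, for self-adjoint `a`, is at most the supremum of
`|φ(a)|` over the states `φ` in `S(A|K)`. -/
theorem IsTopography.norm_corner_le (hM : IsTopography M) {K : Set (GelfandSpectrum M)}
    (hK : IsCompact K) {a : Unital A} (ha : IsSelfAdjoint a) {r : ℝ} (hr : 0 ≤ r)
    (h : ∀ φ ∈ stateSpaceOn K, ‖φ.extend a‖ ≤ r) : ‖corner K a‖ ≤ r := by
  set P := (carrierSubspace K).starProjection
  have hquad : ∀ ξ ∈ carrierSubspace K, ‖⟪ξ, universalRep a ξ⟫_ℂ‖ ≤ r * ‖ξ‖ ^ 2 := by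
    intro ξ hξ
    rcases eq_or_ne ξ 0 with rfl | h0
    · simp
    have hn : ‖ξ‖ ≠ 0 := norm_ne_zero_iff.mpr h0
    obtain ⟨φ, hφ, hφa⟩ := hM.exists_state_of_mem_carrierSubspace hK
      (Submodule.smul_mem _ ((‖ξ‖⁻¹ : ℝ) : ℂ) hξ)
      (by rw [norm_smul, Complex.norm_real, norm_inv, norm_norm, inv_mul_cancel₀ hn])
    have h2 := h φ hφ
    rw [hφa, map_smul, inner_smul_left, inner_smul_right, norm_mul, norm_mul, RCLike.norm_conj,
      Complex.norm_real, norm_inv, norm_norm] at h2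
    field_simp at h2
    rwa [_root_.mul_comm r]
  have hsym : (((P * universalRep a * P : UniversalSpace A →L[ℂ] UniversalSpace A)) :
      UniversalSpace A →ₗ[ℂ] UniversalSpace A).IsSymmetric := by
    rw [← ContinuousLinearMap.isSelfAdjoint_iff_isSymmetric]
    have hPs : star P = P := (isSelfAdjoint_starProjection (carrierSubspace K)).star_eq
    rw [isSelfAdjoint_iff, star_mul, star_mul, hPs, ← map_star, ha.star_eq, mul_assoc]
  change ‖(corner K a : UniversalSpace A →L[ℂ] UniversalSpace A)‖ ≤ r
  rw [coe_corner, ContinuousLinearMap.norm_eq_iSup_rayleighQuotient _ hsym]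
  refine ciSup_le fun ξ => ?_
  rw [abs_div, abs_sq]
  refine div_le_of_le_mul₀ (sq_nonneg _) hr ?_
  rw [ContinuousLinearMap.reApplyInnerSelf_apply]
  refine (RCLike.abs_re_le_norm _).trans ?_
  rw [norm_inner_symm, mul_apply_eq_comp, mul_apply_eq_comp,
    ← Submodule.inner_starProjection_left_eq_right]
  refine (hquad _ (Submodule.starProjection_apply_mem _ _)).trans ?_
  gcongr
  exact Submodule.norm_starProjection_apply_le _ _

/-- `S(A|K)` is weak* compact for compact `K`. -/
theorem IsTopography.isCompact_stateSpaceOn (hM : IsTopography M) {K : Set (GelfandSpectrum M)}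
    (hK : IsCompact K) : @IsCompact _ (weakStarTopology A) (stateSpaceOn K) := by
  let _ := weakStarTopology A
  obtain ⟨g, hg1, -, hgK⟩ := exists_urysohn hM.isClosed hK
  have hind : IsInducing fun φ : State A => StrongDual.toWeakDual φ.toDual := ⟨rfl⟩
  rw [hind.isCompact_iff]
  -- The condition ‖f‖ = 1 is not weak* closed in general. Inside the unit ball it is replaced by
  -- f(g) = 1, which is closed and holds on all of S(A|K).
  let C : Set (WeakDual ℂ A) := {f | (∀ a : A, 0 ≤ f (star a * a)) ∧ f g = 1 ∧
    ∀ m : M, (∀ χ ∈ K, χ m = 0) → f (star (m : A) * (m : A)) = 0}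
  have hC : IsClosed C := by
    have hev : ∀ a : A, Continuous fun f : WeakDual ℂ A => f a := WeakDual.eval_continuous
    have : C = (⋂ a : A, {f : WeakDual ℂ A | 0 ≤ f (star a * a)}) ∩ ({f | f g = 1} ∩
        ⋂ (m : M) (_ : ∀ χ ∈ K, χ m = 0), {f | f (star (m : A) * (m : A)) = 0}) := by
      ext f
      simp [C]
    rw [this]
    refine .inter (isClosed_iInter fun a => ?_) (.inter ?_ ?_)
    · exact isClosed_le continuous_const (hev _)
    · exact isClosed_eq (hev _) continuous_const
    · exact isClosed_iInter fun m => isClosed_iInter fun _ => isClosed_eq (hev _) continuous_const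
  convert (WeakDual.isCompact_closedBall (𝕜 := ℂ) (E := A) 0 1).inter_right hC using 1
  ext f
  constructor
  · rintro ⟨φ, hφ, rfl⟩
    refine ⟨?_, φ.nonneg', ?_, mem_stateSpaceOn_iff.mp hφ⟩
    · show φ.toDual ∈ Metric.closedBall 0 1
      rw [mem_closedBall_zero_iff, φ.norm_eq_one']
    · change φ.toDual (g : A) = 1
      rw [← φ.extend_toUnital, ← φ.inner_vector,
        hM.apply_eq_self hgK (mem_stateSpaceOn_iff_vector_mem.mp hφ), inner_self_eq_norm_sq_to_K,
        φ.norm_vector]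
      simp
  · rintro ⟨hf, hpos, hfg, hfK⟩
    exact ⟨State.ofApplyEqOne (WeakDual.toStrongDual f) hpos (mem_closedBall_zero_iff.mp hf) hg1 hfg,
      mem_stateSpaceOn_iff.mpr hfK, rfl⟩

/-- A topography of a nonzero C⋆-algebra has a character. -/
theorem IsTopography.nonempty_gelfandSpectrum [Nontrivial A] (hM : IsTopography M) :
    Nonempty (GelfandSpectrum M) := by
  have := hM.isClosed
  let _ : NonUnitalCommCStarAlgebra M :=
    { NonUnitalStarSubalgebra.nonUnitalCStarAlgebra M with
      mul_comm := fun x y => Subtype.ext (hM.mul_comm x x.2 y y.2) }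
  obtain ⟨m, hm⟩ : ∃ m : M, m ≠ 0 := by
    by_contra! h0
    obtain ⟨l, hl, hMl⟩ := hM.exists_approximateUnit
    have hne := hl.neBot
    obtain ⟨a, ha⟩ := exists_ne (0 : A)
    refine ha (tendsto_nhds_unique (hl.tendsto_mul_left a) (tendsto_const_nhds.congr' ?_))
    filter_upwards [hMl] with e he
    have : e = 0 := congrArg Subtype.val (h0 ⟨e, he⟩)
    rw [this, mul_zero]
  -- Some character of the unitization is nonzero at `m`, so its restriction to M is a nonzero
  -- character.
  have hiso := gelfandTransform_isometry (Unitization ℂ M)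
  have hne : WeakDual.gelfandTransform ℂ (Unitization ℂ M) (m : Unitization ℂ M) ≠ 0 := by
    intro h
    refine hm (Unitization.inr_injective (R := ℂ) (hiso.injective ?_))
    rw [h, Unitization.inr_zero, map_zero]
  obtain ⟨χ, hχ⟩ : ∃ χ : WeakDual.characterSpace ℂ (Unitization ℂ M),
      χ (m : Unitization ℂ M) ≠ 0 := by
    by_contra! h
    exact hne (ContinuousMap.ext h)
  let f : M →L[ℂ] ℂ :=
    ⟨(χ : WeakDual ℂ (Unitization ℂ M)).toLinearMap.comp
      (Unitization.inrHom ℂ ℂ M),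
      by
        have h := (Unitization.isometry_inr (𝕜 := ℂ) (A := M)).continuous
        exact (map_continuous χ).comp h⟩
  have hf : ∀ x : M, f x = χ (x : Unitization ℂ M) := fun _ => rfl
  refine ⟨⟨StrongDual.toWeakDual f, fun h => hχ ?_, fun x y => ?_⟩⟩
  · rw [← hf]
    exact congrArg (fun F : WeakDual ℂ M => F m) h
  · change f (x * y) = f x * f y
    rw [hf, hf, hf, Unitization.inr_mul, map_mul]

/-- A nonzero C⋆-algebra with a topography has a local state. -/
theorem IsTopography.nonempty_localStates [Nontrivial A] (hM : IsTopography M) :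
    (localStates M).Nonempty := by
  have := hM.isClosed
  obtain ⟨χ⟩ := hM.nonempty_gelfandSpectrum
  obtain ⟨g, hg1, hg2, hgχ⟩ := exists_urysohn hM.isClosed (isCompact_singleton (x := χ))
  have hgχ : χ g = 1 := hgχ χ rfl
  let ψ : M →⋆ₙₐ[ℂ] ℂ :=
    { WeakDual.CharacterSpace.toNonUnitalAlgHom χ with
      map_star' := character_map_star hM.isClosed χ }
  let fM : StrongDual ℂ M :=
    LinearMap.mkContinuous
      { toFun := fun m => χ m
        map_add' := map_add χ
        map_smul' := map_smul χ } 1 fun m => by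
      rw [one_mul]
      exact NonUnitalStarAlgHom.norm_apply_le ψ m
  have hfM : ‖fM‖ ≤ 1 := LinearMap.mkContinuous_norm_le _ zero_le_one _
  let ι : M →ₗᵢ[ℂ] Unital A :=
    { toFun := fun m => toUnital (m : A)
      map_add' := fun x y => map_add toUnital (x : A) y
      map_smul' := fun c x => map_smul toUnital c (x : A)
      norm_map' := fun m => norm_toUnital (m : A) }
  obtain ⟨F, hF, hFn⟩ := exists_extension_norm_eq (LinearMap.range ι.toLinearMap)
    (fM.comp (ι.equivRange.symm : LinearMap.range ι.toLinearMap →L[ℂ] M))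
  have hFM : ∀ m : M, F (toUnital (m : A)) = χ m := by
    intro m
    have h := hF (ι.equivRange m)
    rwa [ContinuousLinearMap.comp_apply, ContinuousLinearEquiv.coe_coe,
      LinearIsometryEquiv.coe_toContinuousLinearEquiv, LinearIsometryEquiv.symm_apply_apply] at h
  have hF1 : ‖F‖ ≤ 1 := by
    rw [hFn]
    refine ContinuousLinearMap.opNorm_le_bound _ zero_le_one fun x => ?_
    refine (fM.le_of_opNorm_le hfM _).trans ?_
    exact (congrArg (1 * ·) (ι.equivRange.symm.norm_map x)).le
  -- Since F(g) = χ(g) = 1, the bounds give |F(1)| ≤ 1 and |F(1) - 2| ≤ 1. These two discs meet only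
  -- at 1.
  have hFone : F 1 = 1 := by
    have h1 : ‖F 1‖ ≤ 1 := by
      refine (F.le_of_opNorm_le hF1 _).trans ?_
      rw [one_mul]
      exact norm_one_le_one _
    have h2 := (F.le_of_opNorm_le hF1 _).trans ((one_mul _).trans_le hg2)
    rw [← Complex.coe_smul, map_sub, map_smul, hFM, hgχ, smul_eq_mul, mul_one] at h2
    have h3 := (Complex.abs_re_le_norm _).trans h2
    have h4 := h1
    rw [← abs_norm, ← sq_le_one_iff_abs_le_one, Complex.sq_norm, Complex.normSq_apply] at h4
    rw [Complex.sub_re, abs_le] at h3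
    have h5 : ((2 : ℝ) : ℂ).re = 2 := rfl
    rw [h5] at h3
    apply Complex.ext
    · have : (F 1).re ≤ 1 := by nlinarith [sq_nonneg (F 1).im]
      rw [Complex.one_re]
      linarith
    · have : 1 ≤ (F 1).re := by linarith
      rw [Complex.one_im]
      exact pow_eq_zero_iff two_ne_zero |>.mp (le_antisymm (by nlinarith) (sq_nonneg _))
  let φ : State A := State.ofApplyEqOne (F.comp (toUnitalL A))
    (fun a => by
      rw [ContinuousLinearMap.comp_apply, toUnitalL_apply, map_mul, map_star]
      exact nonneg_of_norm_le_one F hF1 hFone _)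
    (ContinuousLinearMap.opNorm_le_bound _ zero_le_one fun a => by
      rw [ContinuousLinearMap.comp_apply, toUnitalL_apply, ← norm_toUnital a]
      exact F.le_of_opNorm_le hF1 _)
    hg1 ((hFM g).trans hgχ)
  refine ⟨φ, Set.mem_iUnion.mpr ⟨⟨{χ}, isCompact_singleton⟩, mem_stateSpaceOn_iff.mpr ?_⟩⟩
  intro m hm
  have h := hFM (star m * m)
  rw [map_mul, hm χ rfl, mul_zero] at h
  exact h

end LocalStates


/-! ### Finite nets for the corner seminorms -/

theorem exists_finite_net_of_totallyBounded_image {α β : Type*} [PseudoMetricSpace β] {f : α → β}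
    {S : Set α} (h : TotallyBounded (f '' S)) {ε : ℝ} (hε : 0 < ε) :
    ∃ F ⊆ S, F.Finite ∧ ∀ x ∈ S, ∃ y ∈ F, dist (f x) (f y) < ε := by
  obtain ⟨F, hFS, hF, hcover⟩ := Set.exists_subset_image_finite_and.mp
    (Metric.finite_approx_of_totallyBounded h ε hε)
  refine ⟨F, hFS, hF, fun x hx => ?_⟩
  obtain ⟨_, ⟨y, hy, rfl⟩, hxy⟩ := Set.mem_iUnion₂.mp (hcover (Set.mem_image_of_mem f hx))
  exact ⟨y, hy, hxy⟩

section Corner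

variable {A : Type u} [NonUnitalCStarAlgebra A] {M : NonUnitalStarSubalgebra ℂ A}

theorem corner_sub (K : Set (GelfandSpectrum M)) (a b : Unital A) :
    corner K (a - b) = corner K a - corner K b :=
  Subtype.ext (by
    change _ = (corner K a : UniversalSpace A →L[ℂ] UniversalSpace A) - corner K b
    simp only [coe_corner, map_sub, mul_sub, sub_mul])

theorem norm_corner_sub_le (K : Set (GelfandSpectrum M)) (a b : Unital A) :
    ‖corner K (a - b)‖ ≤ ‖corner K a‖ + ‖corner K b‖ := by
  rw [corner_sub]
  exact norm_sub_le _ _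

theorem norm_corner_smul (K : Set (GelfandSpectrum M)) (c : ℂ) (a : Unital A) :
    ‖corner K (c • a)‖ = ‖c‖ * ‖corner K a‖ :=
  map_smul_eq_mul (cornerSeminorm K) c a

theorem norm_starProjection_conj_le {H : Type*} [NormedAddCommGroup H] [InnerProductSpace ℂ H]
    (V : Submodule ℂ H) [V.HasOrthogonalProjection] (S : H →L[ℂ] H) :
    ‖V.starProjection * S * V.starProjection‖ ≤ ‖S‖ := by
  have h := V.starProjection_norm_le
  calc ‖V.starProjection * S * V.starProjection‖
      ≤ ‖V.starProjection‖ * ‖S‖ * ‖V.starProjection‖ := norm_mul₃_le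
    _ ≤ 1 * ‖S‖ * 1 := by gcongr
    _ = ‖S‖ := by rw [one_mul, mul_one]

theorem norm_corner_le_norm (K : Set (GelfandSpectrum M)) (a : Unital A) : ‖corner K a‖ ≤ ‖a‖ :=
  (norm_starProjection_conj_le (carrierSubspace K) (universalRep a)).trans (norm_universalRep_le a)

/-- For K ⊆ K' the projections satisfy 1_K 1_K' = 1_K = 1_K' 1_K, so the corner for K is a
compression of the corner for K'. -/
theorem norm_corner_mono {K K' : Set (GelfandSpectrum M)} (h : K ⊆ K') (a : Unital A) :
    ‖corner K a‖ ≤ ‖corner K' a‖ := by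
  have h1 : (carrierSubspace K).starProjection * (carrierSubspace K').starProjection =
      (carrierSubspace K).starProjection :=
    Submodule.starProjection_comp_starProjection_of_le (carrierSubspace_mono h)
  have h2 : (carrierSubspace K').starProjection * (carrierSubspace K).starProjection =
      (carrierSubspace K).starProjection := by
    ext1 ξ
    exact Submodule.starProjection_eq_self_iff.mpr
      (carrierSubspace_mono h (Submodule.starProjection_apply_mem _ _))
  have h3 : (corner K a : UniversalSpace A →L[ℂ] UniversalSpace A) =
      (carrierSubspace K).starProjection * corner K' a * (carrierSubspace K).starProjection := by
    rw [coe_corner, coe_corner, ← mul_assoc, ← mul_assoc, h1,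
      mul_assoc _ (carrierSubspace K').starProjection, h2]
  change ‖(corner K a : UniversalSpace A →L[ℂ] UniversalSpace A)‖ ≤ _
  rw [h3]
  exact norm_starProjection_conj_le _ _

theorem State.norm_extend_le_norm_corner {K : Set (GelfandSpectrum M)} {φ : State A}
    (hφ : φ ∈ stateSpaceOn K) (a : Unital A) : ‖φ.extend a‖ ≤ ‖corner K a‖ := by
  rw [← φ.normal_corner hφ]
  exact φ.norm_normal_le _

/-- The set `S` has finite nets for the seminorm `a ↦ ‖1_K a 1_K‖`. -/
def HasCornerNets (K : Set (GelfandSpectrum M)) (S : Set (Unital A)) : Prop :=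
  ∀ ε > 0, ∃ F : Set (Unital A), F.Finite ∧ ∀ a ∈ S, ∃ b ∈ F, ‖corner K (a - b)‖ < ε

theorem HasCornerNets.mono {K K' : Set (GelfandSpectrum M)} {S : Set (Unital A)}
    (h : HasCornerNets K' S) (hK : K ⊆ K') : HasCornerNets K S := fun ε hε => by
  obtain ⟨F, hF, hS⟩ := h ε hε
  refine ⟨F, hF, fun a ha => ?_⟩
  obtain ⟨b, hb, hab⟩ := hS a ha
  exact ⟨b, hb, (norm_corner_mono hK _).trans_lt hab⟩

theorem totallyBounded_image_corner_iff {K : Set (GelfandSpectrum M)} {S : Set (Unital A)} :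
    TotallyBounded (corner K '' S) ↔ HasCornerNets K S := by
  constructor
  · intro h ε hε
    obtain ⟨F, -, hF, hS⟩ := exists_finite_net_of_totallyBounded_image h hε
    refine ⟨F, hF, fun a ha => ?_⟩
    obtain ⟨b, hb, hab⟩ := hS a ha
    exact ⟨b, hb, by rwa [corner_sub, ← dist_eq_norm]⟩
  · intro h
    rw [Metric.totallyBounded_iff]
    intro ε hε
    obtain ⟨F, hF, hS⟩ := h ε hε
    refine ⟨corner K '' F, hF.image _, ?_⟩
    rintro _ ⟨a, ha, rfl⟩
    obtain ⟨b, hb, hab⟩ := hS a ha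
    refine Set.mem_iUnion₂.mpr ⟨corner K b, Set.mem_image_of_mem _ hb, ?_⟩
    rwa [Metric.mem_ball, dist_eq_norm, ← corner_sub]

theorem HasCornerNets.exists_subset {K : Set (GelfandSpectrum M)} {S : Set (Unital A)}
    (h : HasCornerNets K S) {ε : ℝ} (hε : 0 < ε) :
    ∃ F ⊆ S, F.Finite ∧ ∀ a ∈ S, ∃ b ∈ F, ‖corner K (a - b)‖ < ε := by
  obtain ⟨F, hFS, hF, hS⟩ :=
    exists_finite_net_of_totallyBounded_image (totallyBounded_image_corner_iff.mpr h) hε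
  refine ⟨F, hFS, hF, fun a ha => ?_⟩
  obtain ⟨b, hb, hab⟩ := hS a ha
  exact ⟨b, hb, by rwa [corner_sub, ← dist_eq_norm]⟩

/-- A basic neighbourhood involves finitely many compact sets. Their union is compact and its
seminorm dominates all of theirs, so one net for the union serves. -/
theorem isTopographicTotallyBounded_iff {S : Set (Unital A)} :
    IsTopographicTotallyBounded M S ↔
      ∀ K : TopologicalSpace.Compacts (GelfandSpectrum M),
        HasCornerNets (K : Set (GelfandSpectrum M)) S := by
  set p := fun K : TopologicalSpace.Compacts (GelfandSpectrum M) =>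
      cornerSeminorm (K : Set (GelfandSpectrum M)) with hp
  have hbasis := AddGroupFilterBasis.nhds_zero_hasBasis
    (SeminormFamily.moduleFilterBasis p).toAddGroupFilterBasis
  constructor
  · intro h K ε hε
    obtain ⟨F, hF, hS⟩ := h (Seminorm.ball (p K) 0 ε)
      (hbasis.mem_of_mem (SeminormFamily.basisSets_singleton_mem p K hε))
    refine ⟨F, hF, fun a ha => ?_⟩
    obtain ⟨b, hb, hab⟩ := hS a ha
    exact ⟨b, hb, (p K).mem_ball_zero.mp hab⟩
  · intro h U hU
    obtain ⟨V, hV, hVU⟩ := hbasis.mem_iff.mp hU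
    obtain ⟨s, r, hr, rfl⟩ := (SeminormFamily.basisSets_iff p).mp hV
    obtain ⟨F, hF, hS⟩ := h (s.sup id) r hr
    refine ⟨F, hF, fun a ha => ?_⟩
    obtain ⟨b, hb, hab⟩ := hS a ha
    refine ⟨b, hb, hVU ((s.sup p).mem_ball_zero.mpr (Seminorm.finset_sup_apply_lt hr ?_))⟩
    intro K hK
    exact (norm_corner_mono (SetLike.coe_subset_coe.mpr (Finset.le_sup (f := id) hK)) _).trans_lt hab

end Corner

/-! ### The Monge–Kantorovich metric tested on uA and on normalised elements -/

section Kantorovich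

variable {A : Type u} [NonUnitalCStarAlgebra A]

theorem State.extend_eq_re (φ : State A) {a : Unital A} (ha : IsSelfAdjoint a) :
    φ.extend a = ((φ.extend a).re : ℂ) :=
  (Complex.conj_eq_iff_re.mp (ha.map φ.extend)).symm

theorem State.extend_sub_smul_one (φ : State A) (a : Unital A) (c : ℂ) :
    φ.extend (a - c • 1) = φ.extend a - c := by
  rw [map_sub, map_smul, φ.extend_one, smul_eq_mul, mul_one]

namespace LipschitzPair

variable (P : LipschitzPair A)

theorem sub_smul_one_mem_unitBall {a : selfAdjoint (Unital A)} (ha : a ∈ P.unitBall) (r : ℝ) :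
    a - r • (1 : selfAdjoint (Unital A)) ∈ P.unitBall := by
  obtain ⟨h, hL⟩ := ha
  obtain ⟨h1, hL1⟩ : r • (1 : selfAdjoint (Unital A)) ∈
      {a : selfAdjoint (Unital A) | ∃ h : a ∈ P.domain, P.seminorm ⟨a, h⟩ = 0} := by
    rw [P.setOf_eq_zero]
    exact ⟨r, rfl⟩
  refine ⟨P.domain.sub_mem h h1, ?_⟩
  have := map_sub_le_add P.seminorm ⟨a, h⟩ ⟨_, h1⟩
  rw [hL1, add_zero] at this
  exact this.trans hL

theorem isSelfAdjoint_of_mem_ballAt {P : LipschitzPair A} {μ : State A} {x : Unital A}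
    (hx : x ∈ P.ballAt μ) : IsSelfAdjoint x := by
  obtain ⟨a, -, rfl, -⟩ := hx
  exact a.2

theorem sub_smul_one_mem_ballAt {a : selfAdjoint (Unital A)} (ha : a ∈ P.unitBall) (μ : State A) :
    (a : Unital A) - μ.extend a • 1 ∈ P.ballAt μ := by
  refine ⟨_, P.sub_smul_one_mem_unitBall ha (μ.extend a).re, ?_, ?_⟩
  · rw [μ.extend_eq_re a.2, Complex.ofReal_re, Complex.coe_smul]
    rfl
  · rw [μ.extend_sub_smul_one, sub_self]

variable {P} in
-- The metric tests only elements of A. If a = b + c1 is self-adjoint, then a - (Re c)1 = (b + b*)/2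
-- lies in A, has the same Lipschitz bound, and gives the same difference of states.
theorem enorm_extend_sub_le_kantorovich {a : selfAdjoint (Unital A)} (ha : a ∈ P.unitBall)
    (φ ψ : State A) : ‖φ.extend a - ψ.extend a‖ₑ ≤ P.kantorovich φ ψ := by
  obtain ⟨b, c, hbc⟩ := exists_eq_toUnital_add (a : Unital A)
  let y : selfAdjoint A := ⟨(2⁻¹ : ℝ) • (b + star b),
    IsSelfAdjoint.smul (IsSelfAdjoint.all _) (IsSelfAdjoint.add_star_self b)⟩
  have hy : selfAdjointToUnital y = a - c.re • (1 : selfAdjoint (Unital A)) := by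
    refine Subtype.ext ?_
    change toUnital ((2⁻¹ : ℝ) • (b + star b)) = (a : Unital A) - c.re • (1 : Unital A)
    have h2 : (a : Unital A) = (2⁻¹ : ℝ) • ((a : Unital A) + star (a : Unital A)) := by
      rw [selfAdjoint.star_val_eq, ← two_smul ℝ (a : Unital A), smul_smul]
      norm_num
    have h3 : (c.re • (1 : Unital A)) = (2⁻¹ : ℝ) • (c • (1 : Unital A) + star c • (1 : Unital A)) := by
      rw [← add_smul, Complex.star_def, Complex.add_conj, ← Complex.coe_smul, ← Complex.coe_smul,
        smul_smul]
      congr 1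
      push_cast
      ring
    rw [h2, h3, hbc, star_add, ← map_star, Algebra.algebraMap_eq_smul_one, star_smul, star_one,
      ← Complex.coe_smul, map_smul, map_add, Complex.coe_smul, ← smul_sub]
    congr 1
    abel
  have hmem : selfAdjointToUnital y ∈ P.unitBall := by
    rw [hy]
    exact P.sub_smul_one_mem_unitBall ha _
  have key : ∀ χ : State A, χ.toDual (y : A) = χ.extend a - c.re := by
    intro χ
    rw [← χ.extend_toUnital, ← χ.extend_sub_smul_one, Complex.coe_smul]
    exact congrArg (fun z : selfAdjoint (Unital A) => χ.extend z) hy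
  refine le_trans (le_of_eq ?_) (le_iSup₂_of_le y hmem le_rfl)
  rw [key, key, sub_sub_sub_cancel_right]

variable {P} in
-- Normalising at μ subtracts a real multiple of 1, which changes neither the Lipschitz bound nor a
-- difference of states.
theorem kantorovich_le_iff (μ : State A) {φ ψ : State A} {r : ℝ≥0∞} :
    P.kantorovich φ ψ ≤ r ↔ ∀ x ∈ P.ballAt μ, ‖φ.extend x - ψ.extend x‖ₑ ≤ r := by
  constructor
  · rintro h _ ⟨a, ha, rfl, -⟩
    exact (enorm_extend_sub_le_kantorovich ha φ ψ).trans h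
  · refine fun h => iSup₂_le fun a ha => ?_
    have := h _ (P.sub_smul_one_mem_ballAt ha μ)
    rw [φ.extend_sub_smul_one, ψ.extend_sub_smul_one, sub_sub_sub_cancel_right] at this
    rw [← φ.extend_toUnital, ← ψ.extend_toUnital]
    exact this

/-- The Monge-Kantorovich topology is finer than the weak* topology. -/
theorem kantorovich_topology_le :
    P.kantorovichEMetric.toUniformSpace.toTopologicalSpace ≤ weakStarTopology A := by
  let _ := P.kantorovichEMetric
  rw [weakStarTopology, ← continuous_iff_le_induced]
  refine WeakDual.continuous_of_continuous_eval fun a => ?_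
  change Continuous fun φ : State A => φ.toDual a
  have hdom : ∀ b ∈ P.domain, Continuous fun φ : State A => φ.extend (b : Unital A) := by
    intro b hb
    -- The added 1 keeps the scaling invertible when L(b) = 0.
    set N : ℝ := P.seminorm ⟨b, hb⟩ + 1 with hN
    have hN0 : 0 < N := by positivity
    have hmem : N⁻¹ • b ∈ P.unitBall := by
      refine ⟨P.domain.smul_mem _ hb, ?_⟩
      have : (⟨N⁻¹ • b, P.domain.smul_mem _ hb⟩ : P.domain) = N⁻¹ • ⟨b, hb⟩ := rfl
      rw [this, map_smul_eq_mul, norm_inv, Real.norm_of_nonneg hN0.le, inv_mul_le_one₀ hN0]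
      linarith
    have hb' : ∀ φ : State A, φ.extend (b : Unital A) = N * φ.extend (N⁻¹ • b : selfAdjoint _) := by
      intro φ
      have : ((N⁻¹ • b : selfAdjoint (Unital A)) : Unital A) = N⁻¹ • (b : Unital A) := rfl
      rw [this, ← Complex.coe_smul, map_smul, smul_eq_mul, ← mul_assoc, ← Complex.ofReal_mul,
        mul_inv_cancel₀ hN0.ne', Complex.ofReal_one, one_mul]
    simp_rw [hb']
    refine continuous_const.mul (LipschitzWith.continuous (K := 1) fun φ ψ => ?_)
    rw [edist_eq_enorm_sub, ENNReal.coe_one, one_mul]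
    exact enorm_extend_sub_le_kantorovich hmem φ ψ
  have hsa : ∀ b : selfAdjoint (Unital A),
      Continuous fun φ : State A => φ.extend (b : Unital A) := by
    intro b
    -- States are contractive, so norm approximation of `b` from the domain is uniform over all
    -- states.
    refine continuous_of_uniform_approx_of_continuous fun u hu => ?_
    obtain ⟨ε, hε, hεu⟩ := Metric.mem_uniformity_dist.mp hu
    obtain ⟨d, hd, hbd⟩ := Metric.dense_iff.mp P.dense_domain b ε hε
    refine ⟨_, hdom d hbd, fun φ => hεu ?_⟩
    rw [dist_eq_norm, ← map_sub]
    refine (φ.norm_extend_le _).trans_lt ?_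
    rw [Metric.mem_ball, dist_comm, dist_eq_norm] at hd
    exact hd
  have hdecomp : ∀ φ : State A, φ.toDual a = φ.extend (realPart (toUnital a) : Unital A) +
      Complex.I * φ.extend (imaginaryPart (toUnital a) : Unital A) := by
    intro φ
    rw [← φ.extend_toUnital, ← smul_eq_mul, ← map_smul, ← map_add,
      realPart_add_I_smul_imaginaryPart]
  simp_rw [hdecomp]
  exact (hsa _).add (continuous_const.mul (hsa _))

end LipschitzPair

theorem State.continuous_extend_weakStar (x : Unital A) :
    @Continuous _ _ (weakStarTopology A) _ fun φ : State A => φ.extend x := by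
  let _ := weakStarTopology A
  obtain ⟨b, c, rfl⟩ := exists_eq_toUnital_add x
  simp_rw [State.extend_toUnital_add]
  refine Continuous.add ?_ continuous_const
  exact (WeakDual.eval_continuous b).comp
    (continuous_induced_dom (f := fun φ : State A => StrongDual.toWeakDual φ.toDual))

end Kantorovich


/-! ### Corner nets versus the quantum metric -/

variable {A : Type u} [NonUnitalCStarAlgebra A]

theorem State.normal_sub (φ : State A) (S S' : bidual A) :
    φ.normal (S - S') = φ.normal S - φ.normal S' := by
  change ⟪φ.vector, ((S : UniversalSpace A →L[ℂ] UniversalSpace A) - S') φ.vector⟫_ℂ = _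
  rw [sub_apply, inner_sub_right]
  rfl

theorem exists_compacts_of_mem_localStates {M : NonUnitalStarSubalgebra ℂ A} {μ : State A}
    (hμ : μ ∈ localStates M) :
    ∃ K : TopologicalSpace.Compacts (GelfandSpectrum M),
      μ ∈ stateSpaceOn (K : Set (GelfandSpectrum M)) :=
  Set.mem_iUnion.mp hμ

namespace LipschitzTriple

variable (T : LipschitzTriple A)

/-- The compact subsets of the spectrum of the topography. -/
abbrev CompactSets : Type u := TopologicalSpace.Compacts (GelfandSpectrum T.topography)

/-- Existence of corner nets does not depend on the local base state. -/
theorem hasCornerNets_ballAt_of_hasCornerNets {μ₀ μ : State A}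
    (hμ : μ ∈ localStates T.topography)
    (h : ∀ K : T.CompactSets, HasCornerNets (K : Set (GelfandSpectrum T.topography)) (T.ballAt μ₀))
    (K : T.CompactSets) :
    HasCornerNets (K : Set (GelfandSpectrum T.topography)) (T.ballAt μ) := by
  intro ε hε
  obtain ⟨K₁, hK₁⟩ := exists_compacts_of_mem_localStates hμ
  -- With K₁ included, |μ(y - b)| is bounded by the same corner norm. Renormalising at μ thus at
  -- most doubles the error, whence ε / 2.
  obtain ⟨F, hF, hS⟩ := h (K ⊔ K₁) (ε / 2) (half_pos hε)
  have hK : (K : Set (GelfandSpectrum T.topography)) ⊆ (K ⊔ K₁ : T.CompactSets) :=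
    SetLike.coe_subset_coe.mpr le_sup_left
  have hKμ : μ ∈ stateSpaceOn ((K ⊔ K₁ : T.CompactSets) : Set (GelfandSpectrum T.topography)) :=
    stateSpaceOn_mono (SetLike.coe_subset_coe.mpr le_sup_right) hK₁
  refine ⟨(fun b => b - μ.extend b • (1 : Unital A)) '' F, hF.image _, ?_⟩
  rintro _ ⟨a, ha, rfl, hμa⟩
  set y : Unital A := (a : Unital A) - μ₀.extend a • (1 : Unital A) with hy
  obtain ⟨b, hb, hyb⟩ := hS y (T.sub_smul_one_mem_ballAt ha μ₀)
  refine ⟨_, Set.mem_image_of_mem _ hb, ?_⟩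
  have hdiff : (a : Unital A) - (b - μ.extend b • 1) =
      (y - b) - μ.extend (y - b) • (1 : Unital A) := by
    rw [map_sub, hy, μ.extend_sub_smul_one, hμa]
    module
  have h1 : ‖corner (K : Set (GelfandSpectrum T.topography)) (1 : Unital A)‖ ≤ 1 :=
    (norm_corner_le_norm _ _).trans (norm_one_le_one _)
  calc ‖corner (K : Set (GelfandSpectrum T.topography)) ((a : Unital A) - (b - μ.extend b • 1))‖
      ≤ ‖corner (K : Set (GelfandSpectrum T.topography)) (y - b)‖ + ‖μ.extend (y - b)‖ *
          ‖corner (K : Set (GelfandSpectrum T.topography)) (1 : Unital A)‖ := by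
        rw [hdiff, ← norm_corner_smul]
        exact norm_corner_sub_le _ _ _
    _ ≤ ‖corner ((K ⊔ K₁ : T.CompactSets) : Set (GelfandSpectrum T.topography)) (y - b)‖ +
          ‖corner ((K ⊔ K₁ : T.CompactSets) : Set (GelfandSpectrum T.topography)) (y - b)‖ * 1 := by
        gcongr
        · exact norm_corner_mono hK _
        · exact μ.norm_extend_le_norm_corner hKμ _
    _ < ε := by linarith

theorem isRegular_of_hasCornerNets {μ : State A}
    (h : ∀ K : T.CompactSets, HasCornerNets (K : Set (GelfandSpectrum T.topography)) (T.ballAt μ)) :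
    T.IsRegular := by
  intro K
  obtain ⟨F, hF, hS⟩ := h K 1 one_pos
  obtain ⟨R, hR⟩ := (hF.image fun b => ‖corner (K : Set (GelfandSpectrum T.topography)) b‖).bddAbove
  have hbd : ∀ x ∈ T.ballAt μ, ∀ φ ∈ stateSpaceOn (K : Set (GelfandSpectrum T.topography)),
      ‖φ.extend x‖ ≤ 1 + R := by
    intro x hx φ hφ
    obtain ⟨b, hb, hxb⟩ := hS x hx
    have h1 := hR (Set.mem_image_of_mem _ hb)
    have h2 := φ.norm_extend_le_norm_corner hφ (x - b)
    have h3 := φ.norm_extend_le_norm_corner hφ b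
    have h4 : φ.extend x = φ.extend (x - b) + φ.extend b := by rw [map_sub, sub_add_cancel]
    rw [h4]
    exact (norm_add_le _ _).trans (add_le_add (h2.trans hxb.le) (h3.trans h1))
  refine lt_of_le_of_lt (iSup₂_le fun φ hφ => iSup₂_le fun ψ hψ =>
    (LipschitzPair.kantorovich_le_iff μ (r := ENNReal.ofReal ((1 + R) + (1 + R)))).mpr
      fun x hx => ?_) ENNReal.ofReal_lt_top
  rw [← ofReal_norm]
  exact ENNReal.ofReal_le_ofReal
    ((norm_sub_le _ _).trans (add_le_add (hbd x hx φ hφ) (hbd x hx ψ hψ)))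

/-- Tameness picks one K that approximates all states of the set at once. A finite net for that K
then reduces the supremum over L₁ to finitely many weak* continuous evaluations. -/
theorem induced_weakStar_le_of_isTame
    (h : ∀ μ ∈ localStates T.topography,
      ∀ K : T.CompactSets, HasCornerNets (K : Set (GelfandSpectrum T.topography)) (T.ballAt μ))
    {𝒦 : Set (State A)} (h𝒦 : T.IsTame 𝒦) :
    TopologicalSpace.induced ((↑) : 𝒦 → State A) (weakStarTopology A) ≤
      TopologicalSpace.induced ((↑) : 𝒦 → State A)
        T.kantorovichEMetric.toUniformSpace.toTopologicalSpace := by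
  obtain ⟨μ, hμ, htame⟩ := h𝒦
  let _ : TopologicalSpace 𝒦 := TopologicalSpace.induced Subtype.val (weakStarTopology A)
  let _ := T.kantorovichEMetric
  rw [← continuous_iff_le_induced, continuous_iff_continuousAt]
  intro φ
  refine EMetric.tendsto_nhds.mpr fun ε hε => ?_
  obtain ⟨δ, hδ0, hδ⟩ := ENNReal.lt_iff_exists_nnreal_btwn.mp hε
  have hδ0 : (0 : ℝ) < δ := by exact_mod_cast hδ0
  -- Passing from `x` to a net point costs 3η for each of the two states (two tameness errors and
  -- one net error). Comparing the states at the net point costs one more η.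
  set η : ℝ := δ / 7 with hη
  have hη0 : 0 < η := by positivity
  obtain ⟨K, hK⟩ := (htame.eventually_lt_const (ENNReal.ofReal_pos.mpr hη0)).exists
  have hK' : ∀ x ∈ T.ballAt μ, ∀ ψ ∈ 𝒦, ‖ψ.extend x -
      ψ.normal (corner (K : Set (GelfandSpectrum T.topography)) x)‖ ≤ η := by
    intro x hx ψ hψ
    rw [← ψ.normal_toBidual, ← ψ.normal_sub, ← ENNReal.ofReal_le_ofReal_iff hη0.le, ofReal_norm]
    refine le_trans ?_ hK.le
    exact le_iSup₂_of_le x hx (le_iSup₂_of_le ψ hψ le_rfl)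
  obtain ⟨F, hFS, hF, hS⟩ := (h μ hμ K).exists_subset hη0
  have hev : ∀ᶠ ψ : 𝒦 in 𝓝 φ, ∀ b ∈ F, ‖ψ.1.extend b - φ.1.extend b‖ < η := by
    refine (eventually_all_finite hF).mpr fun b _ => ?_
    have hc : Continuous fun ψ : 𝒦 => ψ.1.extend b :=
      @Continuous.comp _ _ _ _ (weakStarTopology A) _ _ _ (State.continuous_extend_weakStar b)
        continuous_induced_dom
    filter_upwards [Metric.tendsto_nhds.mp (hc.tendsto φ) η hη0] with ψ hψ
    rwa [← dist_eq_norm]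
  have hdist : ∀ ψ ∈ 𝒦, ∀ x ∈ T.ballAt μ, ∀ b ∈ T.ballAt μ,
      ‖corner (K : Set (GelfandSpectrum T.topography)) (x - b)‖ < η →
      ‖ψ.extend x - ψ.extend b‖ ≤ 3 * η := by
    intro ψ hψ x hx b hb hxb
    have h1 := hK' x hx ψ hψ
    have h2 := hK' b hb ψ hψ
    have h3 := (ψ.norm_normal_le _).trans hxb.le
    rw [corner_sub, ψ.normal_sub] at h3
    rw [norm_sub_rev] at h2
    have h4 := norm_sub_le_norm_sub_add_norm_sub (ψ.extend x)
      (ψ.normal (corner (K : Set (GelfandSpectrum T.topography)) x)) (ψ.extend b)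
    have h5 := norm_sub_le_norm_sub_add_norm_sub
      (ψ.normal (corner (K : Set (GelfandSpectrum T.topography)) x))
      (ψ.normal (corner (K : Set (GelfandSpectrum T.topography)) b)) (ψ.extend b)
    linarith
  filter_upwards [hev] with ψ hψ
  refine lt_of_le_of_lt ?_ hδ
  change T.kantorovich ψ φ ≤ δ
  refine (LipschitzPair.kantorovich_le_iff μ).mpr fun x hx => ?_
  obtain ⟨b, hb, hxb⟩ := hS x hx
  have h1 := hdist ψ ψ.2 x hx b (hFS hb) hxb
  have h2 := hdist φ φ.2 x hx b (hFS hb) hxb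
  have h3 := hψ b hb
  rw [norm_sub_rev] at h2
  have h4 := norm_sub_le_norm_sub_add_norm_sub (ψ.1.extend x) (ψ.1.extend b) (φ.1.extend x)
  have h5 := norm_sub_le_norm_sub_add_norm_sub (ψ.1.extend b) (φ.1.extend b) (φ.1.extend x)
  rw [← ofReal_norm, ← ENNReal.ofReal_coe_nnreal]
  refine ENNReal.ofReal_le_ofReal ?_
  linarith

/-- A triple with corner nets is a quantum locally compact metric space. -/
theorem isQuantumLocallyCompactMetricSpace_of_hasCornerNets
    (hne : (localStates T.topography).Nonempty)
    (h : ∀ μ ∈ localStates T.topography, ∀ K : T.CompactSets,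
      HasCornerNets (K : Set (GelfandSpectrum T.topography)) (T.ballAt μ)) :
    T.IsQuantumLocallyCompactMetricSpace := by
  obtain ⟨μ, hμ⟩ := hne
  exact ⟨T.isRegular_of_hasCornerNets (h μ hμ), fun 𝒦 h𝒦 =>
    le_antisymm (induced_mono T.kantorovich_topology_le) (T.induced_weakStar_le_of_isTame h h𝒦)⟩

/-- Once K' contains K, compression by 1_K' does not change the value of a state in S(A|K), so the
supremum is eventually exactly 0. -/
theorem isTame_stateSpaceOn {K : T.CompactSets} {μ : State A}
    (hμ : μ ∈ localStates T.topography) :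
    T.IsTame (stateSpaceOn (K : Set (GelfandSpectrum T.topography))) := by
  refine ⟨μ, hμ, tendsto_const_nhds.congr' ?_⟩
  filter_upwards [eventually_ge_atTop K] with K' hK'
  refine (le_antisymm (iSup₂_le fun a _ => iSup₂_le fun φ hφ => ?_) zero_le).symm
  have hφ' := stateSpaceOn_mono (SetLike.coe_subset_coe.mpr hK') hφ
  rw [φ.normal_sub, φ.normal_toBidual, φ.normal_corner hφ', sub_self, enorm_zero]

/-- A quantum locally compact metric space has corner nets. -/
theorem IsQuantumLocallyCompactMetricSpace.hasCornerNets
    (h : T.IsQuantumLocallyCompactMetricSpace) {μ : State A} (hμ : μ ∈ localStates T.topography)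
    (K₀ : T.CompactSets) :
    HasCornerNets (K₀ : Set (GelfandSpectrum T.topography)) (T.ballAt μ) := by
  obtain ⟨K₁, hK₁⟩ := exists_compacts_of_mem_localStates hμ
  -- Enlarging K₀ places μ in S(A|K), so that finite diameter bounds the functions vanishing at μ.
  set K : T.CompactSets := K₀ ⊔ K₁
  refine HasCornerNets.mono (K' := (K : Set (GelfandSpectrum T.topography))) ?_
    (SetLike.coe_subset_coe.mpr le_sup_left)
  set X := stateSpaceOn (K : Set (GelfandSpectrum T.topography))
  have hμX : μ ∈ X := stateSpaceOn_mono (SetLike.coe_subset_coe.mpr le_sup_right) hK₁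
  have hcomp : @IsCompact _ T.kantorovichEMetric.toUniformSpace.toTopologicalSpace X := by
    have h1 := T.isTopography.isCompact_stateSpaceOn K.isCompact
    rw [@isCompact_iff_compactSpace _ (weakStarTopology A)] at h1
    rw [@isCompact_iff_compactSpace _ T.kantorovichEMetric.toUniformSpace.toTopologicalSpace]
    have h2 := h.2 X (T.isTame_stateSpaceOn hμ)
    unfold instTopologicalSpaceSubtype at h1 ⊢
    rwa [h2]
  obtain ⟨D, hD⟩ := ENNReal.lt_iff_exists_nnreal_btwn.mp (h.1 K)
  have hbd : ∀ φ ∈ X, ∀ x ∈ T.ballAt μ, ‖φ.extend x‖ ≤ D := by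
    intro φ hφ x hx
    have h1 : T.kantorovich φ μ ≤ D :=
      (le_iSup₂_of_le φ hφ (le_iSup₂_of_le (f := fun ψ (_ : ψ ∈ X) => T.kantorovich φ ψ)
        μ hμX le_rfl)).trans hD.1.le
    have h2 := (LipschitzPair.kantorovich_le_iff μ).mp h1 x hx
    obtain ⟨a, -, rfl, hμa⟩ := hx
    rw [hμa, sub_zero] at h2
    exact_mod_cast h2
  intro ε hε
  -- Three errors of size η follow: two from replacing φ by a net state, one from the net in ℂⁿ. The
  -- fourth share makes the final inequality strict after the supremum over φ.
  set η : ℝ := ε / 4 with hη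
  have hη0 : 0 < η := by positivity
  obtain ⟨t, htX, htf, hcover⟩ : ∃ t ⊆ X, t.Finite ∧ ∀ φ ∈ X, ∃ ψ ∈ t,
      T.kantorovich φ ψ < ENNReal.ofReal η := by
    let _ := T.kantorovichEMetric
    obtain ⟨t, htX, htf, ht⟩ := EMetric.totallyBounded_iff'.mp hcomp.totallyBounded
      (ENNReal.ofReal η) (ENNReal.ofReal_pos.mpr hη0)
    refine ⟨t, htX, htf, fun φ hφ => ?_⟩
    obtain ⟨ψ, hψ, hφψ⟩ := Set.mem_iUnion₂.mp (ht hφ)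
    exact ⟨ψ, hψ, hφψ⟩
  have := htf.fintype
  let ev : Unital A → t → ℂ := fun x ψ => ψ.1.extend x
  have hev : TotallyBounded (ev '' T.ballAt μ) := by
    refine (isCompact_closedBall (0 : t → ℂ) D).totallyBounded.subset ?_
    rintro _ ⟨x, hx, rfl⟩
    rw [mem_closedBall_zero_iff]
    exact (pi_norm_le_iff_of_nonneg D.coe_nonneg).mpr fun ψ => hbd ψ (htX ψ.2) x hx
  obtain ⟨F, hFS, hF, hS⟩ := exists_finite_net_of_totallyBounded_image hev hη0
  refine ⟨F, hF, fun x hx => ?_⟩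
  obtain ⟨b, hb, hxb⟩ := hS x hx
  refine ⟨b, hb, ?_⟩
  have hsa := (LipschitzPair.isSelfAdjoint_of_mem_ballAt hx).sub
    (LipschitzPair.isSelfAdjoint_of_mem_ballAt (hFS hb))
  refine (T.isTopography.norm_corner_le K.isCompact hsa (r := 3 * η) (by positivity)
    fun φ hφ => ?_).trans_lt (by linarith)
  obtain ⟨ψ, hψ, hφψ⟩ := hcover φ hφ
  have hval : ∀ y ∈ T.ballAt μ, ‖φ.extend y - ψ.extend y‖ ≤ η := by
    intro y hy
    have := (LipschitzPair.kantorovich_le_iff μ).mp hφψ.le y hy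
    rwa [← ofReal_norm, ENNReal.ofReal_le_ofReal_iff hη0.le] at this
  have h1 := hval x hx
  have h2 := hval b (hFS hb)
  have h3 : ‖ψ.extend x - ψ.extend b‖ < η := by
    rw [← dist_eq_norm]
    exact (dist_le_pi_dist (ev x) (ev b) ⟨ψ, hψ⟩).trans_lt hxb
  rw [norm_sub_rev] at h2
  rw [map_sub]
  have h4 := norm_sub_le_norm_sub_add_norm_sub (φ.extend x) (ψ.extend x) (φ.extend b)
  have h5 := norm_sub_le_norm_sub_add_norm_sub (ψ.extend x) (ψ.extend b) (φ.extend b)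
  linarith

end LipschitzTriple

end QuantumMetric

end

theorem mainTheorem1 {A : Type*} [NonUnitalCStarAlgebra A] [Nontrivial A]
    (T : QuantumMetric.LipschitzTriple A) :
    List.TFAE
      [T.IsQuantumLocallyCompactMetricSpace,
       ∀ μ ∈ QuantumMetric.localStates T.topography,
         QuantumMetric.IsTopographicTotallyBounded T.topography (T.ballAt μ),
       ∀ μ ∈ QuantumMetric.localStates T.topography,
         ∀ K : TopologicalSpace.Compacts (QuantumMetric.GelfandSpectrum T.topography),
           TotallyBounded (QuantumMetric.corner (M := T.topography) K '' T.ballAt μ),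
       ∃ μ ∈ QuantumMetric.localStates T.topography,
         QuantumMetric.IsTopographicTotallyBounded T.topography (T.ballAt μ),
       ∃ μ ∈ QuantumMetric.localStates T.topography,
         ∀ K : TopologicalSpace.Compacts (QuantumMetric.GelfandSpectrum T.topography),
           TotallyBounded (QuantumMetric.corner (M := T.topography) K '' T.ballAt μ)] := by
  -- Without a local state, the statements over all local states would hold vacuously and yield
  -- neither a base state nor regularity.
  have hne := T.isTopography.nonempty_localStates
  simp only [QuantumMetric.isTopographicTotallyBounded_iff,
    QuantumMetric.totallyBounded_image_corner_iff]
  tfae_have 1 → 2 := fun h μ hμ K => h.hasCornerNets T hμ K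
  tfae_have 2 → 1 := T.isQuantumLocallyCompactMetricSpace_of_hasCornerNets hne
  tfae_have 2 ↔ 3 := Iff.rfl
  tfae_have 4 ↔ 5 := Iff.rfl
  tfae_have 2 → 4 := fun h => hne.imp fun μ hμ => ⟨hμ, h μ hμ⟩
  tfae_have 4 → 2 := fun ⟨_, _, h⟩ _ hμ => T.hasCornerNets_ballAt_of_hasCornerNets hμ h
  tfae_finish
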